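/- **Setting.** Let $N,M\ge 1$ and let $Z_t=(\bar Z_t,\tilde Z_t)$ be a Markov chain on the finite set $\mathbb Z=\{z_{ij}=(\bar z_i,\tilde z_j): 1\le i\le N,\ 1\le j\le M\}$, where $\bar Z$ and $\tilde Z$ are independent Markov chains with transition matrices $\bar P=(\bar p_{ij})$ and $\tilde P=(\tilde p_{ij})$, so that $Z$ has transition matrix $P=\bar P\otimes\tilde P$. Innovations $\epsilon$ are i.i.d. with distribution $\pi$, and $\beta,R,Y\ge 0$ are measurable functions of $(z,\hat z,\hat\epsilon)$ (discount factor, gross return, income); write $\hat\beta,\hat R,\hat Y$ for their values at $(Z,\hat Z,\hat\epsilon)$. Write $\mathbb E_z$ for the expectation over $(\hat Z,\hat\epsilon)$ given $Z=z$, and $\mathbb P_{(z,\hat z)}$ for the probability over $\hat\epsilon\sim\pi$ given $(Z,\hat Z)=(z,\hat z)$. Let $0<\gamma_1<\dots<\gamma_N$, and let $u(\cdot,z_{ij})$ be the CRRA utility with relative risk aversion $\gamma_i$, that is, $u(c,z_{ij})=c^{1-\gamma_i}/(1-\gamma_i)$ if $\gamma_i\ne1$ and $u(c,z_{ij})=\log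 c$ if $\gamma_i=1$; $u'$ is the derivative in $c$, with $u'(0,z)=\infty$. For a square matrix $A$, $r(A)$ is its spectral radius, and $A$ is irreducible if no simultaneous permutation of its rows and columns makes it block upper triangular with two square diagonal blocks of size at least one. **Standing assumptions.** For all $z\in\mathbb Z$, $\mathbb E_z u'(\hat Y,\hat Z)<\infty$ and $\mathbb E_z\hat\beta\hat R\,u'(\hat Y,\hat Z)<\infty$; and the matrix $K(1)$ with entries $P(z,\hat z)\int\beta(z,\hat z,\hat\epsilon)R(z,\hat z,\hat\epsilon)\,\pi(d\hat\epsilon)$ has finite entries and $r(K(1))<1$. **Optimal consumption.** Let $\mathcal C$ be the set of continuous $c:(0,\infty)\times\mathbb Z\to\mathbb R_+$ that are (weakly) increasing in $w$, satisfy $0<c(w,z)\le w$, and have $\sup_{w,z}|u'(c(w,z),z)-u'(w,z)|<\infty$. For $c\in\mathcal C$, $Tc(w,z)$ is the $\xi\in(0,w]$ that solves $$u'(\xi,z)=\max\left\{\mathbb E_z\hat\beta\hat R\,u'\big(c(\hat R(w-\xi)+\hat Y,\hat Z),\hat Z\big),\ u'(w,z)\right\}.$$ The optimal consumption function $c^*$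 is the fixed point of $T$ in $\mathcal C$. For $1\le i\le N$ let $G_i$ be the $M\times M$ matrix with entries $\bar p_{ii}\,\tilde p_{jk}\int \beta R^{1-\gamma_i}(z_{ij},z_{ik},\hat\epsilon)\,\pi(d\hat\epsilon)$, where $\beta R^{1-\gamma_i}$ is read as $0$ where $R=0$. **Theorem.** Suppose that the standing assumptions hold, that every entry of $\bar P$ is positive, and that $\mathbb P_{(z,\hat z)}(\hat\beta\hat R>0)>0$ for all $z,\hat z\in\mathbb Z$. Then $c^*$ exists and is unique, and $$\lim_{w\to\infty}\frac{c^*(w,z_{ij})}{w}=0\qquad\text{for all } z_{ij}\in\mathbb Z\text{ with } i\ne 1.$$ If in addition $G_1$ has finite entries, is irreducible, and $r(G_1)\ge1$, then the limit is $0$ for all $z_{ij}\in\mathbb Z$. -/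

import Mathlib

open Filter Topology MeasureTheory
open scoped ENNReal

/-- A square matrix is reducible if a simultaneous permutation of its rows and columns makes it
block upper triangular with two square diagonal blocks of size at least one. -/
def MatReducible {n : ℕ} (A : Matrix (Fin n) (Fin n) ℝ) : Prop :=
  ∃ (σ : Equiv.Perm (Fin n)) (k : ℕ), 0 < k ∧ k < n ∧
    ∀ a b : Fin n, k ≤ a.val → b.val < k → A (σ a) (σ b) = 0

/-- A square matrix is irreducible if it is not reducible. -/
def MatIrreducible {n : ℕ} (A : Matrix (Fin n) (Fin n) ℝ) : Prop := ¬ MatReducible A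

/-- The spectral radius of a real square matrix: the largest modulus of a complex eigenvalue. -/
noncomputable def specRad {ι : Type*} [Fintype ι] [DecidableEq ι] (A : Matrix ι ι ℝ) : ℝ≥0∞ :=
  spectralRadius ℂ (A.map (fun x : ℝ => (x : ℂ)))

/-- CRRA utility with relative risk aversion `g`. -/
noncomputable def crraUtility (g c : ℝ) : ℝ :=
  if g = 1 then Real.log c else c ^ (1 - g) / (1 - g)

/-- Data of the optimal savings problem with risk aversion shocks. The exogenous state is
`Z = (Zbar, Ztil)` with values in `Fin N × Fin M`, the innovation takes values in `E`. -/
structure SavingsModel (N M : ℕ) (E : Type*) [MeasurableSpace E] where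
  /-- transition matrix of `Zbar` -/
  Pbar : Matrix (Fin N) (Fin N) ℝ
  Pbar_nonneg : ∀ i k, 0 ≤ Pbar i k
  Pbar_sum : ∀ i, ∑ k, Pbar i k = 1
  /-- transition matrix of `Ztil` -/
  Ptil : Matrix (Fin M) (Fin M) ℝ
  Ptil_nonneg : ∀ j l, 0 ≤ Ptil j l
  Ptil_sum : ∀ j, ∑ l, Ptil j l = 1
  /-- relative risk aversion, driven by `Zbar` only -/
  γ : Fin N → ℝ
  γ_pos : ∀ i, 0 < γ i
  γ_strictMono : StrictMono γ
  /-- distribution of the innovation -/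
  law : Measure E
  law_prob : IsProbabilityMeasure law
  /-- discount factor `β(z, z', ε)` -/
  β : Fin N × Fin M → Fin N × Fin M → E → ℝ
  β_meas : ∀ z z', Measurable (β z z')
  β_nonneg : ∀ z z' e, 0 ≤ β z z' e
  /-- gross return on wealth `R(z, z', ε)` -/
  R : Fin N × Fin M → Fin N × Fin M → E → ℝ
  R_meas : ∀ z z', Measurable (R z z')
  R_nonneg : ∀ z z' e, 0 ≤ R z z' e
  /-- non-financial income `Y(z, z', ε)` -/
  Y : Fin N × Fin M → Fin N × Fin M → E → ℝ
  Y_meas : ∀ z z', Measurable (Y z z')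
  Y_nonneg : ∀ z z' e, 0 ≤ Y z z' e

namespace SavingsModel

variable {N M : ℕ} {E : Type*} [MeasurableSpace E] (m : SavingsModel N M E)

/-- Transition matrix of `Z`: the Kronecker product of those of `Zbar` and `Ztil`. -/
def P : Matrix (Fin N × Fin M) (Fin N × Fin M) ℝ :=
  Matrix.kroneckerMap (fun a b => a * b) m.Pbar m.Ptil

/-- The period utility `u(c, z)`. -/
noncomputable def u (z : Fin N × Fin M) (c : ℝ) : ℝ := crraUtility (m.γ z.1) c

/-- The marginal utility `u'(c, z)`, meaningful for `c > 0`. -/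
noncomputable def du (z : Fin N × Fin M) (c : ℝ) : ℝ := deriv (m.u z) c

/-- The marginal utility with values in `[0, ∞]`, equal to its limit `∞` at `c = 0`
(negative arguments do not occur). -/
noncomputable def duE (z : Fin N × Fin M) (c : ℝ) : ℝ≥0∞ :=
  if 0 < c then ENNReal.ofReal (m.du z c) else ⊤

/-- One-step conditional expectation `E_z f(Z', ε')` of a `[0, ∞]`-valued function of the next
state and innovation. -/
noncomputable def expect (z : Fin N × Fin M) (f : Fin N × Fin M → E → ℝ≥0∞) : ℝ≥0∞ :=
  ∑ z', ENNReal.ofReal (m.P z z') * ∫⁻ e, f z' e ∂m.law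

/-- The matrix `K(θ)`, with entries in `[0, ∞]`. -/
noncomputable def K (θ : ℝ) (z z' : Fin N × Fin M) : ℝ≥0∞ :=
  ENNReal.ofReal (m.P z z') *
    ∫⁻ e, ENNReal.ofReal (m.β z z' e) * ENNReal.ofReal (m.R z z' e) ^ θ ∂m.law

/-- The standing assumptions: finite expected marginal utilities of income, and `K(1)` is a
(finite) matrix of spectral radius less than one. -/
structure StandingAssumptions : Prop where
  fin_exp : ∀ z, m.expect z (fun z' e => m.duE z' (m.Y z z' e)) < ⊤
  fin_exp' : ∀ z, m.expect z (fun z' e =>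
    ENNReal.ofReal (m.β z z' e * m.R z z' e) * m.duE z' (m.Y z z' e)) < ⊤
  K_fin : ∀ z z', m.K 1 z z' < ⊤
  K_spec : specRad (Matrix.of fun z z' => (m.K 1 z z').toReal) < 1

/-- The class of candidate policies. A policy is a function `c w z`; only its values at `w > 0`
matter. -/
structure IsCandidate (c : ℝ → Fin N × Fin M → ℝ) : Prop where
  cont : ∀ z, ContinuousOn (fun w => c w z) (Set.Ioi 0)
  mono : ∀ z, MonotoneOn (fun w => c w z) (Set.Ioi 0)
  pos : ∀ w z, 0 < w → 0 < c w z
  le : ∀ w z, 0 < w → c w z ≤ w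
  bdd : ∃ B : ℝ, ∀ w z, 0 < w → |m.du z (c w z) - m.du z w| ≤ B

/-- `d = T c` for the time iteration operator `T`: at every `(w, z)` with `w > 0`, the value
`ξ = d w z` lies in `(0, w]` and solves
`u'(ξ, z) = max {E_z β' R' u'(c(R' (w - ξ) + Y', Z'), Z'), u'(w, z)}`. -/
def IsTimeIterate (c d : ℝ → Fin N × Fin M → ℝ) : Prop :=
  ∀ w z, 0 < w → 0 < d w z ∧ d w z ≤ w ∧
    m.duE z (d w z) =
      max
        (m.expect z fun z' e => ENNReal.ofReal (m.β z z' e * m.R z z' e) *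
          m.duE z' (c (m.R z z' e * (w - d w z) + m.Y z z' e) z'))
        (m.duE z w)

/-- The optimal consumption function: a fixed point of the time iteration operator in the class
of candidate policies. -/
def IsOptimalConsumption (c : ℝ → Fin N × Fin M → ℝ) : Prop :=
  m.IsCandidate c ∧ m.IsTimeIterate c c

/-- The matrix `Q_i`, `Q_i(j, k) = E β R^(1 - γ_i)` for the transition from `z_ij` to `z_ik`,
where `β R^(1 - γ_i)` is read as `β R · R^(-γ_i)`, with value `0` where `R = 0`. -/
noncomputable def Q (i : Fin N) (j k : Fin M) : ℝ≥0∞ :=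
  ∫⁻ e, (if 0 < m.R (i, j) (i, k) e then
    ENNReal.ofReal (m.β (i, j) (i, k) e * m.R (i, j) (i, k) e ^ (1 - m.γ i)) else 0) ∂m.law

/-- The matrix `G_i = p_ii (Ptil ∘ Q_i)`, with entries in `[0, ∞]`. -/
noncomputable def GE (i : Fin N) (j k : Fin M) : ℝ≥0∞ :=
  ENNReal.ofReal (m.Pbar i i) * (ENNReal.ofReal (m.Ptil j k) * m.Q i j k)

/-- `G_i` as a real matrix, when its entries are finite. -/
noncomputable def G (i : Fin N) : Matrix (Fin M) (Fin M) ℝ :=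
  Matrix.of fun j k => (m.GE i j k).toReal

end SavingsModel

/-! ### Marginal utility and the right-hand side of the Euler equation -/

namespace SavingsModel

variable {N M : ℕ} {E : Type*} [MeasurableSpace E] (m : SavingsModel N M E)

/-! Existence and uniqueness: measure policies by the sup-distance of their marginal utilities. A
perturbation `v` of tomorrow's marginal utility moves today's by at most `K(1) v`. Since `r(K(1)) <
1`, there is a weight `h ≥ 1` with `K(1) h ≤ θ h`, `θ < 1`, so `T` is a contraction in the
`h`-weighted distance (`exists_weight_of_specRad_lt_one`, `MarginalClose.timeIterate`).

States with `i ≠ 0`: the Euler inequality, restricted to one transition to a state of lowest risk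
aversion and combined with `c(x) ≤ x`, gives `κ (s + 1)^(-γ₀) ≤ c^(-γᵢ)` with saving `s = w - c`. As
`γ₀ < γᵢ`, consumption is `o(w)` (`tendsto_div_of_lt`).

States with `i = 0`: put `y_j = liminf (w/c)^γ`. From `w/c = 1 + s/c`, the Euler inequality, `s → ∞`
and Fatou's lemma, `y ≥ φ(G₀ y)` with `φ(x) = (1 + x^(1/γ))^γ` (`rpow_le_liminfRatio`). By
irreducibility `y` is finite everywhere or infinite everywhere. If finite, then `φ(x) > x` gives `G₀
y < y` with `y` positive, hence `r(G₀) < 1`, a contradiction. So `y = ∞`, that is, `c/w → 0`. -/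

theorem P_nonneg (z z' : Fin N × Fin M) : 0 ≤ m.P z z' :=
  mul_nonneg (m.Pbar_nonneg _ _) (m.Ptil_nonneg _ _)

theorem du_eq (z : Fin N × Fin M) {c : ℝ} (hc : 0 < c) : m.du z c = c ^ (-m.γ z.1) := by
  unfold du
  by_cases h : m.γ z.1 = 1
  · have : m.u z = Real.log := by
      funext x; simp [u, crraUtility, h]
    rw [this, Real.deriv_log, h, Real.rpow_neg_one]
  · have h1 : 1 - m.γ z.1 ≠ 0 := fun h' => h (by linarith)
    have : m.u z = fun x => x ^ (1 - m.γ z.1) / (1 - m.γ z.1) := by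
      funext x; simp [u, crraUtility, h]
    rw [this]
    have hd := ((Real.hasDerivAt_rpow_const (x := c) (p := 1 - m.γ z.1)
      (Or.inl hc.ne')).div_const (1 - m.γ z.1)).deriv
    rw [hd, mul_div_cancel_left₀ _ h1]
    congr 1; ring

theorem du_pos (z : Fin N × Fin M) {c : ℝ} (hc : 0 < c) : 0 < m.du z c := by
  rw [m.du_eq z hc]; exact Real.rpow_pos_of_pos hc _

theorem du_lt_du (z : Fin N × Fin M) {a b : ℝ} (ha : 0 < a) (hab : a < b) :
    m.du z b < m.du z a := by
  rw [m.du_eq z ha, m.du_eq z (ha.trans hab)]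
  exact Real.rpow_lt_rpow_of_neg ha hab (neg_neg_of_pos (m.γ_pos _))

theorem du_le_du (z : Fin N × Fin M) {a b : ℝ} (ha : 0 < a) (hab : a ≤ b) :
    m.du z b ≤ m.du z a := by
  rcases hab.eq_or_lt with rfl | h
  · exact le_rfl
  · exact (m.du_lt_du z ha h).le

theorem du_le_du_iff (z : Fin N × Fin M) {a b : ℝ} (ha : 0 < a) (hb : 0 < b) :
    m.du z b ≤ m.du z a ↔ a ≤ b := by
  refine ⟨fun h => ?_, m.du_le_du z ha⟩
  by_contra! h'
  exact absurd h (not_le.2 (m.du_lt_du z hb h'))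

theorem duE_of_pos (z : Fin N × Fin M) {c : ℝ} (hc : 0 < c) :
    m.duE z c = ENNReal.ofReal (m.du z c) := if_pos hc

theorem toReal_duE (z : Fin N × Fin M) {c : ℝ} (hc : 0 < c) :
    (m.duE z c).toReal = m.du z c := by
  rw [m.duE_of_pos z hc, ENNReal.toReal_ofReal (m.du_pos z hc).le]

theorem duE_lt_top (z : Fin N × Fin M) {c : ℝ} (hc : 0 < c) : m.duE z c < ⊤ := by
  rw [m.duE_of_pos z hc]; exact ENNReal.ofReal_lt_top

theorem antitone_duE (z : Fin N × Fin M) : Antitone (m.duE z) := by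
  intro a b hab
  by_cases ha : 0 < a
  · rw [m.duE_of_pos z ha, m.duE_of_pos z (ha.trans_le hab)]
    exact ENNReal.ofReal_le_ofReal (m.du_le_du z ha hab)
  · simp [duE, ha]

theorem duE_le_duE_iff (z : Fin N × Fin M) {a b : ℝ} (ha : 0 < a) (hb : 0 < b) :
    m.duE z b ≤ m.duE z a ↔ a ≤ b := by
  rw [m.duE_of_pos z ha, m.duE_of_pos z hb, ENNReal.ofReal_le_ofReal_iff (m.du_pos z ha).le,
    m.du_le_du_iff z ha hb]

theorem duE_lt_duE_iff (z : Fin N × Fin M) {a b : ℝ} (ha : 0 < a) (hb : 0 < b) :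
    m.duE z b < m.duE z a ↔ a < b := by
  rw [← not_le, m.duE_le_duE_iff z hb ha, not_le]

theorem duE_injOn (z : Fin N × Fin M) {a b : ℝ} (ha : 0 < a) (hb : 0 < b)
    (h : m.duE z a = m.duE z b) : a = b :=
  le_antisymm ((m.duE_le_duE_iff z ha hb).1 h.ge) ((m.duE_le_duE_iff z hb ha).1 h.le)

theorem continuousOn_du (z : Fin N × Fin M) : ContinuousOn (m.du z) (Set.Ioi 0) := by
  have : ContinuousOn (fun c : ℝ => c ^ (-m.γ z.1)) (Set.Ioi 0) := fun x hx =>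
    (Real.continuousAt_rpow_const x _ (Or.inl (ne_of_gt hx))).continuousWithinAt
  exact this.congr fun x hx => m.du_eq z hx

theorem continuousAt_duE (z : Fin N × Fin M) {c : ℝ} (hc : 0 < c) :
    ContinuousAt (m.duE z) c := by
  have h1 : ContinuousAt (fun x => ENNReal.ofReal (m.du z x)) c :=
    ENNReal.continuous_ofReal.continuousAt.comp ((m.continuousOn_du z).continuousAt
      (Ioi_mem_nhds hc))
  refine h1.congr ?_
  filter_upwards [Ioi_mem_nhds hc] with x hx
  exact (m.duE_of_pos z hx).symm

/-- The right-hand side `E_z β' R' u'(c(R' s + Y', Z'), Z')` of the Euler equation, as a function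
of saving `s`. -/
noncomputable def eulerRHS (c : ℝ → Fin N × Fin M → ℝ) (z : Fin N × Fin M) (s : ℝ) : ℝ≥0∞ :=
  m.expect z fun z' e => ENNReal.ofReal (m.β z z' e * m.R z z' e) *
    m.duE z' (c (m.R z z' e * s + m.Y z z' e) z')

theorem expect_mono_ae {z : Fin N × Fin M} {f g : Fin N × Fin M → E → ℝ≥0∞}
    (h : ∀ z', 0 < m.P z z' → ∀ᵐ e ∂m.law, f z' e ≤ g z' e) : m.expect z f ≤ m.expect z g := by
  refine Finset.sum_le_sum fun z' _ => ?_
  rcases (m.P_nonneg z z').eq_or_lt with h0 | h0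
  · simp [← h0]
  · gcongr 1
    exact lintegral_mono_ae (h z' h0)

variable {m}

/-- Marginal utility is infinite at zero, so its finite expectation excludes zero income.
Next-period wealth is then positive even when nothing is saved, which is where the properties of a
candidate are available. -/
theorem StandingAssumptions.ae_Y_pos (hA : m.StandingAssumptions) {z z' : Fin N × Fin M}
    (h : 0 < m.P z z') : ∀ᵐ e ∂m.law, 0 < m.Y z z' e := by
  have h1 : ENNReal.ofReal (m.P z z') * ∫⁻ e, m.duE z' (m.Y z z' e) ∂m.law < ⊤ :=
    (Finset.single_le_sum (f := fun z' => ENNReal.ofReal (m.P z z') *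
      ∫⁻ e, m.duE z' (m.Y z z' e) ∂m.law) (fun _ _ => zero_le) (Finset.mem_univ z')).trans_lt
      (hA.fin_exp z)
  have h2 : ∫⁻ e, m.duE z' (m.Y z z' e) ∂m.law ≠ ⊤ := by
    intro h'
    rw [h', ENNReal.mul_top (by simpa using h)] at h1
    exact lt_irrefl _ h1
  have h3 := ae_lt_top ((m.antitone_duE z').measurable.comp (m.Y_meas z z')) h2
  filter_upwards [h3] with e he
  by_contra h0
  simp [duE, h0] at he

theorem eulerRHS_le_add_K (hA : m.StandingAssumptions) {c d : ℝ → Fin N × Fin M → ℝ}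
    {v : Fin N × Fin M → ℝ≥0∞} {s : ℝ} (hs : 0 ≤ s)
    (h : ∀ w z, 0 < w → m.duE z (c w z) ≤ m.duE z (d w z) + v z) (z : Fin N × Fin M) :
    m.eulerRHS c z s ≤ m.eulerRHS d z s + ∑ z', m.K 1 z z' * v z' := by
  have h1 : m.eulerRHS c z s ≤ m.expect z fun z' e =>
      ENNReal.ofReal (m.β z z' e * m.R z z' e) *
        m.duE z' (d (m.R z z' e * s + m.Y z z' e) z') +
      ENNReal.ofReal (m.β z z' e) * ENNReal.ofReal (m.R z z' e) ^ (1 : ℝ) * v z' := by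
    refine m.expect_mono_ae fun z' hz' => ?_
    filter_upwards [hA.ae_Y_pos hz'] with e he
    have : 0 < m.R z z' e * s + m.Y z z' e :=
      add_pos_of_nonneg_of_pos (mul_nonneg (m.R_nonneg _ _ _) hs) he
    rw [ENNReal.rpow_one, ← ENNReal.ofReal_mul (m.β_nonneg _ _ _), ← mul_add]
    gcongr
    exact h _ _ this
  refine h1.trans (le_of_eq ?_)
  unfold eulerRHS expect K
  rw [← Finset.sum_add_distrib]
  refine Finset.sum_congr rfl fun z' _ => ?_
  have hm : Measurable fun e => ENNReal.ofReal (m.β z z' e) *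
      ENNReal.ofReal (m.R z z' e) ^ (1 : ℝ) :=
    (m.β_meas z z').ennreal_ofReal.mul ((m.R_meas z z').ennreal_ofReal.pow_const _)
  -- The policies are arbitrary here, so only the `K` summand is known to be measurable.
  rw [lintegral_add_right _ (hm.mul_const _), lintegral_mul_const _ hm]
  ring

theorem eulerRHS_anti (hA : m.StandingAssumptions) {c : ℝ → Fin N × Fin M → ℝ}
    (hc : m.IsCandidate c) (z : Fin N × Fin M) {s t : ℝ} (hs : 0 ≤ s) (hst : s ≤ t) :
    m.eulerRHS c z t ≤ m.eulerRHS c z s := by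
  refine m.expect_mono_ae fun z' hz' => ?_
  filter_upwards [hA.ae_Y_pos hz'] with e he
  have hR := m.R_nonneg z z' e
  have h1 : 0 < m.R z z' e * s + m.Y z z' e := add_pos_of_nonneg_of_pos (mul_nonneg hR hs) he
  have h2 : m.R z z' e * s + m.Y z z' e ≤ m.R z z' e * t + m.Y z z' e := by gcongr
  gcongr
  exact m.antitone_duE z' (hc.mono z' h1 (h1.trans_le h2) h2)

theorem eulerRHS_zero_lt_top (hA : m.StandingAssumptions) {c : ℝ → Fin N × Fin M → ℝ}
    (hc : m.IsCandidate c) (z : Fin N × Fin M) : m.eulerRHS c z 0 < ⊤ := by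
  obtain ⟨B, hB⟩ := hc.bdd
  -- Compare with the policy that consumes everything: at zero saving its right-hand side is the
  -- second finite expectation of the standing assumptions.
  refine (eulerRHS_le_add_K hA (d := fun w _ => w) (v := fun _ => ENNReal.ofReal B) le_rfl
    (fun w z hw => ?_) z).trans_lt ?_
  · rw [m.duE_of_pos z hw, m.duE_of_pos z (hc.pos w z hw)]
    refine (ENNReal.ofReal_le_ofReal ?_).trans ENNReal.ofReal_add_le
    linarith [(abs_le.1 (hB w z hw)).2]
  · refine ENNReal.add_lt_top.2 ⟨?_, ?_⟩
    · simpa [eulerRHS] using hA.fin_exp' z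
    · exact ENNReal.sum_lt_top.2 fun z' _ => ENNReal.mul_lt_top (hA.K_fin z z')
        ENNReal.ofReal_lt_top

theorem eulerRHS_lt_top (hA : m.StandingAssumptions) {c : ℝ → Fin N × Fin M → ℝ}
    (hc : m.IsCandidate c) (z : Fin N × Fin M) {s : ℝ} (hs : 0 ≤ s) : m.eulerRHS c z s < ⊤ :=
  (eulerRHS_anti hA hc z le_rfl hs).trans_lt (eulerRHS_zero_lt_top hA hc z)

/-- A candidate is unconstrained at `x ≤ 0`; the value `⊤` there makes the function antitone on the
whole line. -/
theorem IsCandidate.measurable_duE {c : ℝ → Fin N × Fin M → ℝ} (hc : m.IsCandidate c)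
    (z : Fin N × Fin M) : Measurable fun x => if 0 < x then m.duE z (c x z) else ⊤ := by
  refine Antitone.measurable fun a b hab => ?_
  by_cases ha : 0 < a
  · simp only [ha, ha.trans_le hab, if_true]
    exact m.antitone_duE z (hc.mono z ha (ha.trans_le hab) hab)
  · simp [ha]

/-- Dominated convergence: the integrand decreases in saving, so its value at zero saving is an
integrable bound. -/
theorem continuousOn_eulerRHS (hA : m.StandingAssumptions) {c : ℝ → Fin N × Fin M → ℝ}
    (hc : m.IsCandidate c) (z : Fin N × Fin M) :
    ContinuousOn (m.eulerRHS c z) (Set.Ici 0) := by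
  set g : Fin N × Fin M → ℝ → ℝ≥0∞ := fun z' x => if 0 < x then m.duE z' (c x z') else ⊤ with hg
  have hint : ∀ z', 0 < m.P z z' → ∀ s, 0 ≤ s →
      ∫⁻ e, ENNReal.ofReal (m.β z z' e * m.R z z' e) *
        m.duE z' (c (m.R z z' e * s + m.Y z z' e) z') ∂m.law =
      ∫⁻ e, ENNReal.ofReal (m.β z z' e * m.R z z' e) *
        g z' (m.R z z' e * s + m.Y z z' e) ∂m.law := by
    intro z' hz' s hs
    refine lintegral_congr_ae ?_
    filter_upwards [hA.ae_Y_pos hz'] with e he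
    have : 0 < m.R z z' e * s + m.Y z z' e :=
      add_pos_of_nonneg_of_pos (mul_nonneg (m.R_nonneg _ _ _) hs) he
    simp [hg, this]
  have hmeas : ∀ z' s, Measurable fun e => ENNReal.ofReal (m.β z z' e * m.R z z' e) *
      g z' (m.R z z' e * s + m.Y z z' e) := fun z' s =>
    ((m.β_meas z z').mul (m.R_meas z z')).ennreal_ofReal.mul
      ((hc.measurable_duE z').comp (((m.R_meas z z').mul_const s).add (m.Y_meas z z')))
  have hcont : ContinuousOn (fun s => ∑ z', ENNReal.ofReal (m.P z z') *
      ∫⁻ e, ENNReal.ofReal (m.β z z' e * m.R z z' e) *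
        g z' (m.R z z' e * s + m.Y z z' e) ∂m.law) (Set.Ici 0) := by
    intro s hs
    refine tendsto_finsetSum _ fun z' _ => ?_
    rcases (m.P_nonneg z z').eq_or_lt with h0 | h0
    · simpa [← h0] using tendsto_const_nhds
    refine ENNReal.Tendsto.const_mul ?_ (Or.inr ENNReal.ofReal_ne_top)
    refine tendsto_lintegral_filter_of_dominated_convergence
      (fun e => ENNReal.ofReal (m.β z z' e * m.R z z' e) * g z' (m.R z z' e * 0 + m.Y z z' e))
      (Eventually.of_forall fun t => hmeas z' t) ?_ ?_ ?_
    · filter_upwards [self_mem_nhdsWithin] with t ht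
      filter_upwards [hA.ae_Y_pos h0] with e he
      have hR := m.R_nonneg z z' e
      have h1 : 0 < m.R z z' e * 0 + m.Y z z' e := by simpa using he
      have h2 : m.R z z' e * 0 + m.Y z z' e ≤ m.R z z' e * t + m.Y z z' e := by
        have : (0 : ℝ) ≤ t := ht
        gcongr
      simp only [hg, h1, h1.trans_le h2, if_true]
      gcongr
      exact m.antitone_duE z' (hc.mono z' h1 (h1.trans_le h2) h2)
    · have h1 := eulerRHS_zero_lt_top hA hc z
      have h2 := (ENNReal.sum_lt_top.1 h1 z' (Finset.mem_univ _)).ne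
      intro h
      rw [hint z' h0 0 le_rfl] at h2
      rw [h, ENNReal.mul_top (by simpa using h0)] at h2
      exact h2 rfl
    · filter_upwards [hA.ae_Y_pos h0] with e he
      refine ENNReal.Tendsto.const_mul ?_ (Or.inr ENNReal.ofReal_ne_top)
      have hs' : (0 : ℝ) ≤ s := hs
      have h1 : 0 < m.R z z' e * s + m.Y z z' e :=
        add_pos_of_nonneg_of_pos (mul_nonneg (m.R_nonneg _ _ _) hs') he
      have hga : ContinuousAt (g z') (m.R z z' e * s + m.Y z z' e) := by
        have : ContinuousAt (fun x => m.duE z' (c x z')) (m.R z z' e * s + m.Y z z' e) :=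
          ContinuousAt.comp (g := m.duE z') (f := fun x => c x z')
            (m.continuousAt_duE z' (hc.pos _ _ h1))
            ((hc.cont z').continuousAt (Ioi_mem_nhds h1))
        refine this.congr ?_
        filter_upwards [Ioi_mem_nhds h1] with x hx
        simp only [hg]
        rw [if_pos (Set.mem_Ioi.1 hx)]
      have hlin : Continuous fun t : ℝ => m.R z z' e * t + m.Y z z' e := by fun_prop
      exact (ContinuousAt.comp (f := fun t : ℝ => m.R z z' e * t + m.Y z z' e) hga
        hlin.continuousAt).tendsto.mono_left nhdsWithin_le_nhds
  refine hcont.congr fun t ht => Finset.sum_congr rfl fun z' _ => ?_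
  rcases (m.P_nonneg z z').eq_or_lt with h0 | h0
  · simp [← h0]
  · rw [hint z' h0 t ht]

end SavingsModel

/-! ### The time iteration operator -/

namespace SavingsModel

variable {N M : ℕ} {E : Type*} [MeasurableSpace E] {m : SavingsModel N M E}

theorem exists_solution_euler (hA : m.StandingAssumptions) {c : ℝ → Fin N × Fin M → ℝ}
    (hc : m.IsCandidate c) (z : Fin N × Fin M) {w : ℝ} (hw : 0 < w) :
    ∃ ξ, 0 < ξ ∧ ξ ≤ w ∧ m.duE z ξ = max (m.eulerRHS c z (w - ξ)) (m.duE z w) := by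
  -- `C` bounds both terms of the maximum for every saving level. The point `a` with `u'(a) = C` is
  -- thus a left endpoint for the intermediate value theorem.
  set C : ℝ := (m.eulerRHS c z 0).toReal + m.du z w with hC
  have hγ := m.γ_pos z.1
  have hduw := m.du_pos z hw
  have hC0 : 0 < C := add_pos_of_nonneg_of_pos ENNReal.toReal_nonneg hduw
  set a : ℝ := C ^ (-(m.γ z.1)⁻¹) with ha
  have ha0 : 0 < a := Real.rpow_pos_of_pos hC0 _
  have hdua : m.du z a = C := by
    rw [m.du_eq z ha0, ha, ← Real.rpow_mul hC0.le]
    rw [neg_mul_neg, inv_mul_cancel₀ hγ.ne', Real.rpow_one]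
  have haw : a ≤ w := by
    rw [← m.du_le_du_iff z ha0 hw, hdua, hC]
    linarith [ENNReal.toReal_nonneg (a := m.eulerRHS c z 0)]
  have hF : ContinuousOn (fun ξ => (m.eulerRHS c z (w - ξ)).toReal) (Set.Icc a w) := by
    have h1 : ContinuousOn (fun ξ => m.eulerRHS c z (w - ξ)) (Set.Icc a w) :=
      (continuousOn_eulerRHS hA hc z).comp (f := fun ξ : ℝ => w - ξ) (by fun_prop)
        fun ξ hξ => sub_nonneg.2 hξ.2
    exact ENNReal.continuousOn_toReal.comp h1 fun ξ hξ =>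
      (eulerRHS_lt_top hA hc z (sub_nonneg.2 hξ.2)).ne
  have hf : ContinuousOn (fun ξ => m.du z ξ -
      max (m.eulerRHS c z (w - ξ)).toReal (m.du z w)) (Set.Icc a w) :=
    ((m.continuousOn_du z).mono fun ξ hξ => ha0.trans_le hξ.1).sub
      (hF.sup continuousOn_const)
  obtain ⟨ξ, hξ, h0⟩ := intermediate_value_Icc' haw hf (show (0 : ℝ) ∈ Set.Icc _ _ from by
    refine ⟨?_, ?_⟩
    · linarith [le_max_right (m.eulerRHS c z (w - w)).toReal (m.du z w)]
    · have : (m.eulerRHS c z (w - a)).toReal ≤ (m.eulerRHS c z 0).toReal :=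
        ENNReal.toReal_mono (eulerRHS_zero_lt_top hA hc z).ne
          (eulerRHS_anti hA hc z le_rfl (sub_nonneg.2 haw))
      rw [hdua, sub_nonneg]
      exact max_le (by linarith) (by linarith [ENNReal.toReal_nonneg (a := m.eulerRHS c z 0)]))
  have hξ0 : 0 < ξ := ha0.trans_le hξ.1
  refine ⟨ξ, hξ0, hξ.2, ?_⟩
  have hfin := (eulerRHS_lt_top hA hc z (sub_nonneg.2 hξ.2)).ne
  rw [← ENNReal.toReal_eq_toReal_iff' (m.duE_lt_top z hξ0).ne
    (max_lt hfin.lt_top (m.duE_lt_top z hw)).ne, ENNReal.toReal_max hfin (m.duE_lt_top z hw).ne,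
    m.toReal_duE z hξ0, m.toReal_duE z hw]
  exact sub_eq_zero.1 h0

theorem exists_isTimeIterate (hA : m.StandingAssumptions) {c : ℝ → Fin N × Fin M → ℝ}
    (hc : m.IsCandidate c) : ∃ d, m.IsTimeIterate c d := by
  have : ∀ w z, ∃ ξ, 0 < w →
      0 < ξ ∧ ξ ≤ w ∧ m.duE z ξ = max (m.eulerRHS c z (w - ξ)) (m.duE z w) := fun w z => by
    by_cases hw : 0 < w
    · obtain ⟨ξ, hξ⟩ := exists_solution_euler hA hc z hw
      exact ⟨ξ, fun _ => hξ⟩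
    · exact ⟨0, fun h => absurd h hw⟩
  choose d hd using this
  exact ⟨d, fun w z hw => hd w z hw⟩

namespace IsTimeIterate

variable {c d c' d' : ℝ → Fin N × Fin M → ℝ}

theorem duE_eq (h : m.IsTimeIterate c d) {w : ℝ} (hw : 0 < w) (z : Fin N × Fin M) :
    m.duE z (d w z) = max (m.eulerRHS c z (w - d w z)) (m.duE z w) := (h w z hw).2.2

theorem monotone (hA : m.StandingAssumptions) (hc : m.IsCandidate c) (h : m.IsTimeIterate c d)
    (z : Fin N × Fin M) {w₁ w₂ : ℝ} (h₁ : 0 < w₁) (h₂ : w₁ ≤ w₂) : d w₁ z ≤ d w₂ z := by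
  have hw₂ := h₁.trans_le h₂
  by_contra! hlt
  have e := (m.duE_lt_duE_iff z (h w₂ z hw₂).1 (h w₁ z h₁).1).2 hlt
  rw [h.duE_eq h₁, h.duE_eq hw₂] at e
  refine absurd e (not_lt.2 (max_le_max ?_ (m.antitone_duE z h₂)))
  exact eulerRHS_anti hA hc z (sub_nonneg.2 (h w₁ z h₁).2.1) (by linarith)

/-- With `monotone`, this makes the new policy 1-Lipschitz in wealth, a form of continuity that
survives pointwise limits. -/
theorem saving_monotone (hA : m.StandingAssumptions) (hc : m.IsCandidate c)
    (h : m.IsTimeIterate c d) (z : Fin N × Fin M) {w₁ w₂ : ℝ} (h₁ : 0 < w₁) (h₂ : w₁ ≤ w₂) :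
    w₁ - d w₁ z ≤ w₂ - d w₂ z := by
  have hw₂ := h₁.trans_le h₂
  obtain ⟨p₁, l₁, -⟩ := h w₁ z h₁
  obtain ⟨p₂, l₂, -⟩ := h w₂ z hw₂
  by_contra! hlt
  have e := (m.duE_lt_duE_iff z p₁ p₂).2 (by linarith)
  have e₁ := h.duE_eq h₁ z
  rcases max_cases (m.eulerRHS c z (w₁ - d w₁ z)) (m.duE z w₁) with ⟨hm, -⟩ | ⟨hm, -⟩
  · rw [hm] at e₁
    have h3 := eulerRHS_anti hA hc z (sub_nonneg.2 l₂) hlt.le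
    have h4 : m.eulerRHS c z (w₂ - d w₂ z) ≤ m.duE z (d w₂ z) := by
      rw [h.duE_eq hw₂]; exact le_max_left _ _
    exact absurd e (not_lt.2 (e₁.le.trans (h3.trans h4)))
  · rw [hm] at e₁
    have := m.duE_injOn z p₁ h₁ e₁
    linarith

theorem isCandidate (hA : m.StandingAssumptions) (hc : m.IsCandidate c)
    (h : m.IsTimeIterate c d) : m.IsCandidate d where
  cont z := by
    refine Metric.continuousOn_iff.2 fun w hw ε hε => ⟨ε, hε, fun x hx hd => ?_⟩
    refine lt_of_le_of_lt ?_ hd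
    rw [Real.dist_eq, Real.dist_eq, abs_le]
    rcases le_total x w with hxw | hxw
    · have h1 := h.monotone hA hc z hx hxw
      have h2 := h.saving_monotone hA hc z hx hxw
      rw [abs_of_nonpos (by linarith)]
      constructor <;> linarith
    · have h1 := h.monotone hA hc z hw hxw
      have h2 := h.saving_monotone hA hc z hw hxw
      rw [abs_of_nonneg (by linarith)]
      constructor <;> linarith
  mono z w₁ h₁ w₂ _ h₂ := h.monotone hA hc z h₁ h₂
  pos w z hw := (h w z hw).1
  le w z hw := (h w z hw).2.1
  bdd := by
    refine ⟨∑ z, (m.eulerRHS c z 0).toReal, fun w z hw => ?_⟩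
    obtain ⟨p, l, -⟩ := h w z hw
    have h1 := m.du_le_du z p l
    rw [abs_of_nonneg (by linarith)]
    have h2 : (m.eulerRHS c z 0).toReal ≤ ∑ z, (m.eulerRHS c z 0).toReal :=
      Finset.single_le_sum (f := fun z => (m.eulerRHS c z 0).toReal)
        (fun _ _ => ENNReal.toReal_nonneg) (Finset.mem_univ z)
    have h3 := congrArg ENNReal.toReal (h.duE_eq hw z)
    have hfin := (eulerRHS_lt_top hA hc z (sub_nonneg.2 l)).ne
    rw [ENNReal.toReal_max hfin (m.duE_lt_top z hw).ne, m.toReal_duE z p, m.toReal_duE z hw] at h3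
    have h4 : (m.eulerRHS c z (w - d w z)).toReal ≤ (m.eulerRHS c z 0).toReal :=
      ENNReal.toReal_mono (eulerRHS_zero_lt_top hA hc z).ne
        (eulerRHS_anti hA hc z le_rfl (sub_nonneg.2 l))
    have h5 := m.du_pos z hw
    have h6 : m.du z (d w z) ≤ (m.eulerRHS c z 0).toReal + m.du z w := by
      rw [h3]
      exact max_le (by linarith) (by linarith [ENNReal.toReal_nonneg (a := m.eulerRHS c z 0)])
    linarith

/-- Blackwell-type discounting of the time iteration operator in terms of marginal utilities. -/
theorem duE_le_add_K (hA : m.StandingAssumptions) (hc : m.IsCandidate c)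
    (h : m.IsTimeIterate c d) (h' : m.IsTimeIterate c' d') {v : Fin N × Fin M → ℝ≥0∞}
    (hv : ∀ w z, 0 < w → m.duE z (c w z) ≤ m.duE z (c' w z) + v z) {w : ℝ} (hw : 0 < w)
    (z : Fin N × Fin M) :
    m.duE z (d w z) ≤ m.duE z (d' w z) + ∑ z', m.K 1 z z' * v z' := by
  obtain ⟨p, l, -⟩ := h w z hw
  obtain ⟨p', l', -⟩ := h' w z hw
  -- Only `d < d'` needs work: then `d` saves more, so its Euler term is at most the one at the
  -- saving of `d'`, where `c` and `c'` can be compared.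
  rcases le_or_gt (d' w z) (d w z) with hle | hlt
  · exact (m.antitone_duE z hle).trans le_self_add
  · rw [h.duE_eq hw]
    refine max_le ?_ ((m.antitone_duE z l').trans le_self_add)
    calc m.eulerRHS c z (w - d w z) ≤ m.eulerRHS c z (w - d' w z) :=
          eulerRHS_anti hA hc z (sub_nonneg.2 l') (by linarith)
      _ ≤ m.eulerRHS c' z (w - d' w z) + ∑ z', m.K 1 z z' * v z' :=
          eulerRHS_le_add_K hA (sub_nonneg.2 l') hv z
      _ ≤ _ := by
          gcongr
          rw [h'.duE_eq hw]; exact le_max_left _ _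

end IsTimeIterate

end SavingsModel

/-! ### Nonnegative matrices: spectral radius and irreducibility -/

section SpectralRadius

variable {ι : Type*} [Fintype ι] [DecidableEq ι]

attribute [local instance] Matrix.linftyOpNormedRing Matrix.linftyOpNormedAlgebra

/-- A nonnegative matrix of spectral radius less than one has a positive weight vector with respect
to which it is a contraction. -/
theorem exists_weight_of_specRad_lt_one {A : Matrix ι ι ℝ} (hA : ∀ i j, 0 ≤ A i j)
    (hr : specRad A < 1) :
    ∃ (h : ι → ℝ) (θ : ℝ), 0 < θ ∧ θ < 1 ∧ (∀ i, 1 ≤ h i) ∧ ∀ i, ∑ j, A i j * h j ≤ θ * h i := by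
  set B : Matrix ι ι ℂ := A.map (fun x : ℝ => (x : ℂ)) with hB
  have hlim := spectrum.pow_nnnorm_pow_one_div_tendsto_nhds_spectralRadius B
  obtain ⟨q, hq1, hq2⟩ := ENNReal.lt_iff_exists_nnreal_btwn.1 hr
  obtain ⟨θ, hθ1, hθ2⟩ := exists_between (show q < 1 by exact_mod_cast hq2)
  have hθ0 : 0 < θ := lt_of_le_of_lt zero_le hθ1
  -- Gelfand's formula.
  obtain ⟨n, hn, hn1⟩ := ((hlim.eventually_lt_const hq1).and (eventually_ge_atTop 1)).exists
  have hnorm : ‖B ^ n‖ ≤ (θ : ℝ) ^ n := by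
    have hn0 : (n : ℝ) ≠ 0 := by positivity
    have h1 : ((‖B ^ n‖₊ : ℝ≥0∞) ^ (1 / (n : ℝ))) ^ (n : ℝ) ≤ (θ : ℝ≥0∞) ^ (n : ℝ) :=
      ENNReal.rpow_le_rpow (hn.le.trans (by exact_mod_cast hθ1.le)) (by positivity)
    rw [← ENNReal.rpow_mul, one_div, inv_mul_cancel₀ hn0, ENNReal.rpow_one,
      ENNReal.rpow_natCast] at h1
    exact_mod_cast h1
  have hpow : ∀ k i j, 0 ≤ (A ^ k) i j := by
    intro k
    induction k with
    | zero => intro i j; rw [pow_zero, Matrix.one_apply]; split_ifs <;> norm_num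
    | succ k ih =>
      intro i j
      rw [pow_succ, Matrix.mul_apply]
      exact Finset.sum_nonneg fun l _ => mul_nonneg (ih i l) (hA l j)
  have hrow : ∀ i, ∑ j, (A ^ n) i j ≤ (θ : ℝ) ^ n := by
    intro i
    have hBn : B ^ n = (A ^ n).map (fun x : ℝ => (x : ℂ)) := by
      have := map_pow (Complex.ofRealHom.mapMatrix (m := ι)) A n
      exact this.symm
    have h1 := (Matrix.linfty_opNorm_mulVec (B ^ n) (fun _ => (1 : ℂ))).trans
      (mul_le_mul_of_nonneg_right hnorm (norm_nonneg _))
    have h2 : ‖(fun _ : ι => (1 : ℂ))‖ ≤ 1 := (pi_norm_le_iff_of_nonneg zero_le_one).2 (by simp)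
    have h3 := (norm_le_pi_norm ((B ^ n).mulVec fun _ => (1 : ℂ)) i).trans h1
    have h4 : ((B ^ n).mulVec fun _ => (1 : ℂ)) i = ((∑ j, (A ^ n) i j : ℝ) : ℂ) := by
      simp [Matrix.mulVec, dotProduct, hBn]
    rw [h4, Complex.norm_real, Real.norm_eq_abs,
      abs_of_nonneg (Finset.sum_nonneg fun j _ => hpow n i j)] at h3
    refine h3.trans ?_
    exact mul_le_of_le_one_right (by positivity) h2
  have hθ0' : (0 : ℝ) < θ := by exact_mod_cast hθ0
  -- The weight is the truncated resolvent `h = ∑_{k<n} θ^(-k) A^k 1`. Telescoping gives `A h = θ (h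
  -- - 1 + θ^(-n) A^n 1)`, and the bracket is at most `h` because the row sums of `A^n` are at most
  -- `θ^n`.
  let a : ℕ → ι → ℝ := fun k i => (θ : ℝ)⁻¹ ^ k * ∑ j, (A ^ k) i j
  have ha0 : ∀ i, a 0 i = 1 := fun i => by simp [a, Matrix.one_apply]
  have ha : ∀ k i, 0 ≤ a k i := fun k i =>
    mul_nonneg (by positivity) (Finset.sum_nonneg fun j _ => hpow k i j)
  have hstep : ∀ k i, ∑ j, A i j * a k j = θ * a (k + 1) i := by
    intro k i
    simp only [a, pow_succ' A, Matrix.mul_apply]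
    rw [Finset.sum_comm, Finset.mul_sum, Finset.mul_sum]
    refine Finset.sum_congr rfl fun l _ => ?_
    rw [← Finset.mul_sum, pow_succ]
    field_simp
  refine ⟨fun i => ∑ k ∈ Finset.range n, a k i, θ, hθ0', by exact_mod_cast hθ2, fun i => ?_,
    fun i => ?_⟩
  · rw [← ha0 i]
    exact Finset.single_le_sum (f := fun k => a k i) (fun k _ => ha k i)
      (Finset.mem_range.2 hn1)
  · have h1 : ∑ j, A i j * ∑ k ∈ Finset.range n, a k j =
        θ * ∑ k ∈ Finset.range n, a (k + 1) i := by
      simp only [Finset.mul_sum]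
      rw [Finset.sum_comm]
      exact Finset.sum_congr rfl fun k _ => hstep k i
    rw [h1]
    gcongr 1
    have h2 := Finset.sum_range_succ' (fun k => a k i) n
    rw [Finset.sum_range_succ, ha0] at h2
    have h3 : a n i ≤ 1 := by
      simp only [a]
      calc (θ : ℝ)⁻¹ ^ n * ∑ j, (A ^ n) i j ≤ (θ : ℝ)⁻¹ ^ n * (θ : ℝ) ^ n := by
            gcongr; exact hrow i
        _ = 1 := by rw [← mul_pow, inv_mul_cancel₀ hθ0'.ne', one_pow]
    linarith

end SpectralRadius

section CollatzWielandt

variable {ι : Type*} [Fintype ι] [DecidableEq ι]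

/-- A nonnegative matrix that strictly decreases some positive vector has spectral radius less than
one. -/
theorem specRad_lt_one_of_mulVec_lt {A : Matrix ι ι ℝ} (hA : ∀ i j, 0 ≤ A i j) {y : ι → ℝ}
    (hy : ∀ i, 0 < y i) (h : ∀ i, ∑ j, A i j * y j < y i) : specRad A < 1 := by
  obtain ⟨θ, hθ0, hθ1, hθ⟩ : ∃ θ : ℝ, 0 ≤ θ ∧ θ < 1 ∧ ∀ i, ∑ j, A i j * y j ≤ θ * y i := by
    have hlt : ∀ i, (∑ j, A i j * y j) / y i < 1 := fun i => (div_lt_one (hy i)).2 (h i)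
    have h0 : ∀ i, 0 ≤ (∑ j, A i j * y j) / y i := fun i =>
      div_nonneg (Finset.sum_nonneg fun j _ => mul_nonneg (hA i j) (hy j).le) (hy i).le
    rcases isEmpty_or_nonempty ι with hι | hι
    · exact ⟨0, le_rfl, zero_lt_one, fun i => (hι.false i).elim⟩
    · obtain ⟨i₀, hi₀⟩ := Finite.exists_max fun i => (∑ j, A i j * y j) / y i
      exact ⟨_, h0 i₀, hlt i₀, fun i => (div_le_iff₀ (hy i)).1 (hi₀ i)⟩
  have key : ∀ μ ∈ spectrum ℂ (A.map (fun x : ℝ => (x : ℂ))), ‖μ‖ ≤ θ := by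
    intro μ hμ
    rw [← Matrix.spectrum_toLin', ← Module.End.hasEigenvalue_iff_mem_spectrum] at hμ
    obtain ⟨v, hv⟩ := hμ.exists_hasEigenvector
    have hv0 : v ≠ 0 := hv.2
    have hev : ∀ i, ∑ j, (A i j : ℂ) * v j = μ * v i := fun i => by
      have := congrFun hv.apply_eq_smul i
      simpa [Matrix.mulVec, dotProduct] using this
    obtain ⟨i₁, hi₁⟩ : ∃ i, v i ≠ 0 := by
      by_contra! h'; exact hv0 (funext h')
    have : Nonempty ι := ⟨i₁⟩
    -- Evaluate the eigenvalue equation where `|v|` is largest relative to `y`.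
    obtain ⟨i₀, hi₀⟩ := Finite.exists_max fun i => ‖v i‖ / y i
    set t := ‖v i₀‖ / y i₀ with ht
    have ht0 : 0 < t := (div_pos (norm_pos_iff.2 hi₁) (hy i₁)).trans_le (hi₀ i₁)
    have hvt : ∀ i, ‖v i‖ ≤ t * y i := fun i => (div_le_iff₀ (hy i)).1 (hi₀ i)
    have hv₀ : ‖v i₀‖ = t * y i₀ := by rw [ht, div_mul_cancel₀ _ (hy i₀).ne']
    have h1 : ‖μ‖ * (t * y i₀) ≤ θ * (t * y i₀) := by
      calc ‖μ‖ * (t * y i₀) = ‖∑ j, (A i₀ j : ℂ) * v j‖ := by rw [hev, norm_mul, hv₀]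
        _ ≤ ∑ j, A i₀ j * ‖v j‖ := by
            refine (norm_sum_le _ _).trans (Finset.sum_le_sum fun j _ => ?_)
            rw [norm_mul, Complex.norm_real, Real.norm_eq_abs, abs_of_nonneg (hA _ _)]
        _ ≤ ∑ j, t * (A i₀ j * y j) := Finset.sum_le_sum fun j _ => by
            rw [mul_left_comm]
            exact mul_le_mul_of_nonneg_left (hvt j) (hA _ _)
        _ = t * ∑ j, A i₀ j * y j := by rw [Finset.mul_sum]
        _ ≤ t * (θ * y i₀) := mul_le_mul_of_nonneg_left (hθ i₀) ht0.le
        _ = θ * (t * y i₀) := by ring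
    exact le_of_mul_le_mul_right h1 (mul_pos ht0 (hy i₀))
  have : specRad A ≤ ENNReal.ofReal θ := by
    refine iSup₂_le fun μ hμ => ?_
    rw [← enorm_eq_nnnorm, ← ofReal_norm]
    exact ENNReal.ofReal_le_ofReal (key μ hμ)
  exact this.trans_lt (by simpa using hθ1)

/-- For an irreducible matrix, a set of indices that is nonempty and closed under predecessors is
everything. -/
theorem MatIrreducible.eq_univ {n : ℕ} {A : Matrix (Fin n) (Fin n) ℝ} (hA : MatIrreducible A)
    (S : Finset (Fin n)) (hS : S.Nonempty) (h : ∀ j k, k ∈ S → A j k ≠ 0 → j ∈ S) :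
    S = Finset.univ := by
  by_contra hne
  have hcard : S.card < n := by
    simpa using Finset.card_lt_univ_of_notMem (s := S) (x := _)
      (Classical.not_forall.1 fun h' => hne (Finset.eq_univ_iff_forall.2 h')).choose_spec
  -- Extended to a permutation, `e` lists `S` first. Entries with row outside `S` and column in `S`
  -- vanish by closedness, which would make `A` reducible.
  have e : {x : Fin n // x.val < S.card} ≃ {x : Fin n // x ∈ S} :=
    Fintype.equivOfCardEq (by
      rw [Fintype.card_coe, Fintype.card_subtype, Fin.card_filter_val_lt, min_eq_right hcard.le])
  refine hA ⟨e.extendSubtype, S.card, hS.card_pos, hcard, fun a b ha hb => ?_⟩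
  by_contra h0
  exact e.extendSubtype_not_mem a (not_lt.2 ha) (h _ _ (e.extendSubtype_mem b hb) h0)

end CollatzWielandt

/-! ### Contraction in marginal utilities; existence and uniqueness -/

namespace SavingsModel

variable {N M : ℕ} {E : Type*} [MeasurableSpace E] {m : SavingsModel N M E}

/-- The marginal utilities of `c` and `d` differ by at most `b` times the weight `h`. -/
def MarginalClose (m : SavingsModel N M E) (h : Fin N × Fin M → ℝ)
    (c d : ℝ → Fin N × Fin M → ℝ) (b : ℝ) : Prop :=
  ∀ w z, 0 < w → |m.du z (c w z) - m.du z (d w z)| ≤ b * h z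

theorem MarginalClose.symm {h : Fin N × Fin M → ℝ} {c d : ℝ → Fin N × Fin M → ℝ} {b : ℝ}
    (hcd : m.MarginalClose h c d b) : m.MarginalClose h d c b := fun w z hw => by
  rw [abs_sub_comm]; exact hcd w z hw

theorem IsCandidate.marginalClose {c d : ℝ → Fin N × Fin M → ℝ} (hc : m.IsCandidate c)
    (hd : m.IsCandidate d) {h : Fin N × Fin M → ℝ} (hh : ∀ z, 1 ≤ h z) :
    ∃ b, 0 ≤ b ∧ m.MarginalClose h c d b := by
  obtain ⟨B, hB⟩ := hc.bdd
  obtain ⟨B', hB'⟩ := hd.bdd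
  refine ⟨|B| + |B'|, by positivity, fun w z hw => ?_⟩
  calc |m.du z (c w z) - m.du z (d w z)|
      ≤ |m.du z (c w z) - m.du z w| + |m.du z w - m.du z (d w z)| := abs_sub_le _ _ _
    _ ≤ |B| + |B'| := by
        rw [abs_sub_comm (m.du z w)]
        exact add_le_add ((hB w z hw).trans (le_abs_self _)) ((hB' w z hw).trans (le_abs_self _))
    _ ≤ (|B| + |B'|) * h z := le_mul_of_one_le_right (by positivity) (hh z)

theorem duE_le_add_ofReal_iff (z : Fin N × Fin M) {x y r : ℝ} (hx : 0 < x) (hy : 0 < y)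
    (hr : 0 ≤ r) : m.duE z x ≤ m.duE z y + ENNReal.ofReal r ↔ m.du z x ≤ m.du z y + r := by
  have := m.du_pos z hy
  rw [m.duE_of_pos z hx, m.duE_of_pos z hy, ← ENNReal.ofReal_add this.le hr,
    ENNReal.ofReal_le_ofReal_iff (by positivity)]

section Contraction

variable {h : Fin N × Fin M → ℝ} {θ : ℝ} (hA : m.StandingAssumptions) (hh : ∀ z, 1 ≤ h z)
  (hKh : ∀ z, ∑ z', (m.K 1 z z').toReal * h z' ≤ θ * h z)
include hA hh hKh

/-- The bound `b h` is sent to `b K(1) h ≤ b θ h`; the one-sided estimate is applied in both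
directions. -/
theorem MarginalClose.timeIterate {c d c' d' : ℝ → Fin N × Fin M → ℝ} (hc : m.IsCandidate c)
    (hc' : m.IsCandidate c') (hd : m.IsTimeIterate c d) (hd' : m.IsTimeIterate c' d') {b : ℝ}
    (hb : 0 ≤ b) (hcc : m.MarginalClose h c c' b) : m.MarginalClose h d d' (b * θ) := by
  have key : ∀ {c d c' d' : ℝ → Fin N × Fin M → ℝ}, m.IsCandidate c → m.IsCandidate c' →
      m.IsTimeIterate c d → m.IsTimeIterate c' d' → m.MarginalClose h c c' b →
      ∀ w z, 0 < w → m.du z (d w z) ≤ m.du z (d' w z) + b * θ * h z := by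
    intro c d c' d' hc hc' hd hd' hcc w z hw
    have h0 : ∀ z, 0 ≤ b * h z := fun z => mul_nonneg hb (zero_le_one.trans (hh z))
    have h1 := hd.duE_le_add_K hA hc hd' (v := fun z => ENNReal.ofReal (b * h z))
      (fun w z hw => (duE_le_add_ofReal_iff z (hc.pos w z hw) (hc'.pos w z hw) (h0 z)).2 (by
        linarith [(abs_le.1 (hcc w z hw)).2])) hw z
    have h2 : ∑ z', m.K 1 z z' * ENNReal.ofReal (b * h z') =
        ENNReal.ofReal (b * ∑ z', (m.K 1 z z').toReal * h z') := by
      rw [Finset.mul_sum, ENNReal.ofReal_sum_of_nonneg fun z' _ => by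
        rw [mul_left_comm]; exact mul_nonneg ENNReal.toReal_nonneg (h0 z')]
      refine Finset.sum_congr rfl fun z' _ => ?_
      rw [mul_left_comm, ENNReal.ofReal_mul ENNReal.toReal_nonneg,
        ENNReal.ofReal_toReal (hA.K_fin z z').ne]
    rw [h2] at h1
    have h3 : 0 ≤ b * ∑ z', (m.K 1 z z').toReal * h z' := mul_nonneg hb
      (Finset.sum_nonneg fun z' _ => mul_nonneg ENNReal.toReal_nonneg (zero_le_one.trans (hh z')))
    rw [duE_le_add_ofReal_iff z (hd w z hw).1 (hd' w z hw).1 h3] at h1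
    rw [mul_assoc]
    exact h1.trans (by gcongr; exact hKh z)
  intro w z hw
  have h1 := key hc hc' hd hd' hcc w z hw
  have h2 := key hc' hc hd' hd hcc.symm w z hw
  rw [abs_le]
  constructor <;> linarith

theorem IsOptimalConsumption.eqOn (hθ0 : 0 ≤ θ) (hθ1 : θ < 1) {c c' : ℝ → Fin N × Fin M → ℝ}
    (hc : m.IsOptimalConsumption c) (hc' : m.IsOptimalConsumption c') {w : ℝ}
    (z : Fin N × Fin M) (hw : 0 < w) : c w z = c' w z := by
  obtain ⟨b, hb, hcc⟩ := hc.1.marginalClose hc'.1 hh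
  have hn : ∀ n : ℕ, m.MarginalClose h c c' (b * θ ^ n) := by
    intro n
    induction n with
    | zero => simpa using hcc
    | succ n ih =>
      rw [pow_succ, ← mul_assoc]
      exact MarginalClose.timeIterate hA hh hKh hc.1 hc'.1 hc.2 hc'.2 (by positivity) ih
  have hlim : Tendsto (fun n : ℕ => b * θ ^ n * h z) atTop (𝓝 0) := by
    simpa using ((tendsto_pow_atTop_nhds_zero_of_lt_one hθ0 hθ1).const_mul b).mul_const (h z)
  have h0 := ge_of_tendsto' hlim fun n => hn n w z hw
  have h1 : m.du z (c w z) = m.du z (c' w z) := sub_eq_zero.1 (abs_nonpos_iff.1 h0)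
  have p := hc.1.pos w z hw
  have p' := hc'.1.pos w z hw
  exact le_antisymm ((m.du_le_du_iff z p p').1 h1.ge) ((m.du_le_du_iff z p' p).1 h1.le)

/-- Banach iteration from `c(w) = w`, with completeness done by hand: marginal utilities converge
geometrically at each point, and inverting `u'` turns their limit into a policy. -/
theorem exists_isOptimalConsumption_of_weight (hθ0 : 0 ≤ θ) (hθ1 : θ < 1) :
    ∃ c, m.IsOptimalConsumption c := by
  have hid : m.IsCandidate fun w _ => w :=
    ⟨fun _ => continuousOn_id, fun _ => monotoneOn_id, fun _ _ hw => hw, fun _ _ _ => le_rfl,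
      0, fun w z _ => by simp⟩
  choose T hT using fun c : {c // m.IsCandidate c} => exists_isTimeIterate hA c.2
  let step : {c // m.IsCandidate c} → {c // m.IsCandidate c} := fun c =>
    ⟨T c, (hT c).isCandidate hA c.2⟩
  let cs : ℕ → {c // m.IsCandidate c} := fun n => step^[n] ⟨_, hid⟩
  have hcs : ∀ n, m.IsTimeIterate (cs n).1 (cs (n + 1)).1 := fun n => by
    have : cs (n + 1) = step (cs n) := Function.iterate_succ_apply' _ _ _
    rw [this]
    exact hT (cs n)
  obtain ⟨b, hb, h01⟩ := (cs 0).2.marginalClose (cs 1).2 hh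
  have hclose : ∀ n, m.MarginalClose h (cs n).1 (cs (n + 1)).1 (b * θ ^ n) := by
    intro n
    induction n with
    | zero => simpa using h01
    | succ n ih =>
      rw [pow_succ, ← mul_assoc]
      exact MarginalClose.timeIterate hA hh hKh (cs n).2 (cs (n + 1)).2 (hcs n) (hcs (n + 1))
        (by positivity) ih
  have hdist : ∀ w z, 0 < w → ∀ n, dist (m.du z ((cs n).1 w z)) (m.du z ((cs (n + 1)).1 w z)) ≤
      b * h z * θ ^ n := fun w z hw n => by
    rw [Real.dist_eq, mul_right_comm]
    exact hclose n w z hw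
  have hex : ∀ w z, ∃ l, 0 < w → Tendsto (fun n => m.du z ((cs n).1 w z)) atTop (𝓝 l) := by
    intro w z
    by_cases hw : 0 < w
    · obtain ⟨l, hl⟩ := cauchySeq_tendsto_of_complete
        (cauchySeq_of_le_geometric θ (b * h z) hθ1 (hdist w z hw))
      exact ⟨l, fun _ => hl⟩
    · exact ⟨0, fun h => absurd h hw⟩
  choose l hl using hex
  -- All iterates have marginal utility at least `u'(w)`, so the limit stays where `u'` has a
  -- continuous inverse.
  have hl0 : ∀ w z, 0 < w → 0 < l w z := fun w z hw =>
    (m.du_pos z hw).trans_le (ge_of_tendsto' (hl w z hw) fun n =>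
      m.du_le_du z ((cs n).2.pos w z hw) ((cs n).2.le w z hw))
  set c : ℝ → Fin N × Fin M → ℝ := fun w z => l w z ^ (-(m.γ z.1)⁻¹) with hc
  have hcpos : ∀ w z, 0 < w → 0 < c w z := fun w z hw => Real.rpow_pos_of_pos (hl0 w z hw) _
  have hduc : ∀ w z, 0 < w → m.du z (c w z) = l w z := fun w z hw => by
    rw [m.du_eq z (hcpos w z hw), hc]
    simp only
    rw [← Real.rpow_mul (hl0 w z hw).le, neg_mul_neg, inv_mul_cancel₀ (m.γ_pos _).ne',
      Real.rpow_one]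
  have hlim : ∀ w z, 0 < w → Tendsto (fun n => (cs n).1 w z) atTop (𝓝 (c w z)) := by
    intro w z hw
    have h1 := (hl w z hw).rpow_const (p := -(m.γ z.1)⁻¹) (Or.inl (hl0 w z hw).ne')
    refine h1.congr fun n => ?_
    have hp := (cs n).2.pos w z hw
    rw [m.du_eq z hp, ← Real.rpow_mul hp.le, neg_mul_neg, mul_inv_cancel₀ (m.γ_pos _).ne',
      Real.rpow_one]
  have hclim : ∀ n, m.MarginalClose h (cs n).1 c (b * θ ^ n / (1 - θ)) := by
    intro n w z hw
    have h1 := dist_le_of_le_geometric_of_tendsto θ (b * h z) hθ1 (hdist w z hw) (hl w z hw) n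
    rw [Real.dist_eq] at h1
    rw [hduc w z hw]
    refine h1.trans (le_of_eq ?_)
    ring
  have hsav : ∀ (z) (w₁ w₂ : ℝ), 0 < w₁ → w₁ ≤ w₂ → w₁ - c w₁ z ≤ w₂ - c w₂ z := by
    intro z w₁ w₂ h₁ h₂
    -- The index is shifted by one because monotone saving is known for images under the operator.
    refine le_of_tendsto_of_tendsto'
      (((hlim w₁ z h₁).comp (tendsto_add_atTop_nat 1)).const_sub w₁)
      (((hlim w₂ z (h₁.trans_le h₂)).comp (tendsto_add_atTop_nat 1)).const_sub w₂) fun n => ?_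
    exact (hcs n).saving_monotone hA (cs n).2 z h₁ h₂
  have hmono : ∀ z, MonotoneOn (fun w => c w z) (Set.Ioi 0) := fun z w₁ h₁ w₂ h₂ h₁₂ =>
    le_of_tendsto_of_tendsto' (hlim w₁ z h₁) (hlim w₂ z h₂) fun n => (cs n).2.mono z h₁ h₂ h₁₂
  have hcand : m.IsCandidate c := by
    refine ⟨fun z => ?_, hmono, hcpos, fun w z hw => ?_, ?_⟩
    · refine Metric.continuousOn_iff.2 fun w hw ε hε => ⟨ε, hε, fun x hx hd => ?_⟩
      refine lt_of_le_of_lt ?_ hd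
      rw [Real.dist_eq, Real.dist_eq, abs_le]
      rcases le_total x w with hxw | hxw
      · have h1 := hmono z hx hw hxw
        have h2 := hsav z x w hx hxw
        simp only at h1
        rw [abs_of_nonpos (by linarith)]
        constructor <;> linarith
      · have h1 := hmono z hw hx hxw
        have h2 := hsav z w x hw hxw
        simp only at h1
        rw [abs_of_nonneg (by linarith)]
        constructor <;> linarith
    · exact le_of_tendsto' (hlim w z hw) fun n => (cs n).2.le w z hw
    · refine ⟨∑ z, b * θ ^ 0 / (1 - θ) * h z, fun w z hw => ?_⟩
      rw [abs_sub_comm]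
      refine (hclim 0 w z hw).trans ?_
      exact Finset.single_le_sum (f := fun z => b * θ ^ 0 / (1 - θ) * h z)
        (fun z _ => mul_nonneg (div_nonneg (by positivity) (by linarith))
          (zero_le_one.trans (hh z))) (Finset.mem_univ z)
  -- The iterates converge both to `c` and, by contraction, to its image `d`; hence `d = c`.
  obtain ⟨d, hd⟩ := exists_isTimeIterate hA hcand
  have hcd : ∀ w z, 0 < w → d w z = c w z := by
    intro w z hw
    have h1 : Tendsto (fun n : ℕ => b * θ ^ n / (1 - θ) * θ * h z) atTop (𝓝 0) := by
      simpa using (((((tendsto_pow_atTop_nhds_zero_of_lt_one hθ0 hθ1).const_mul b).div_const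
        (1 - θ)).mul_const θ).mul_const (h z))
    have h2 : Tendsto (fun n => m.du z ((cs (n + 1)).1 w z)) atTop (𝓝 (m.du z (d w z))) := by
      rw [tendsto_iff_dist_tendsto_zero]
      refine squeeze_zero (fun _ => dist_nonneg) (fun n => ?_) h1
      rw [Real.dist_eq]
      exact MarginalClose.timeIterate hA hh hKh (cs n).2 hcand (hcs n) hd
        (div_nonneg (by positivity) (by linarith)) (hclim n) w z hw
    have h3 := tendsto_nhds_unique h2 ((hl w z hw).comp (tendsto_add_atTop_nat 1))
    rw [← hduc w z hw] at h3
    have p := (hd w z hw).1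
    have p' := hcpos w z hw
    exact le_antisymm ((m.du_le_du_iff z p p').1 h3.ge) ((m.du_le_du_iff z p' p).1 h3.le)
  exact ⟨c, hcand, fun w z hw => hcd w z hw ▸ hd w z hw⟩

end Contraction

theorem StandingAssumptions.exists_weight (hA : m.StandingAssumptions) :
    ∃ (h : Fin N × Fin M → ℝ) (θ : ℝ), 0 < θ ∧ θ < 1 ∧ (∀ z, 1 ≤ h z) ∧
      ∀ z, ∑ z', (m.K 1 z z').toReal * h z' ≤ θ * h z :=
  exists_weight_of_specRad_lt_one (fun _ _ => ENNReal.toReal_nonneg) hA.K_spec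

end SavingsModel

/-! ### Asymptotics from a single transition -/

theorem ENNReal.sum_liminf_le {ι κ : Type*} [Fintype κ] {u : Filter ι} [u.IsCountablyGenerated]
    (f : κ → ι → ℝ≥0∞) :
    ∑ k, liminf (f k) u ≤ liminf (fun i => ∑ k, f k i) u := by
  let _ : MeasurableSpace κ := ⊤
  -- Fatou's lemma for the counting measure.
  have h := lintegral_liminf_le (μ := Measure.count) (u := u) (f := fun i (k : κ) => f k i)
    fun i => measurable_from_top
  simpa only [lintegral_fintype, Measure.count_singleton, mul_one] using h

namespace SavingsModel

variable {N M : ℕ} {E : Type*} [MeasurableSpace E] {m : SavingsModel N M E}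
  {c : ℝ → Fin N × Fin M → ℝ}

theorem exists_le_eulerRHS (hA : m.StandingAssumptions) (hc : m.IsCandidate c)
    {z z' : Fin N × Fin M} (hP : 0 < m.P z z')
    (hβR : 0 < m.law {e | 0 < m.β z z' e * m.R z z' e}) :
    ∃ κ C : ℝ, 0 < κ ∧ 0 < C ∧
      ∀ s, 0 ≤ s → ENNReal.ofReal κ * m.duE z' (C * (s + 1)) ≤ m.eulerRHS c z s := by
  have := m.law_prob
  -- These events exhaust `{βR > 0}`, so one has positive probability. On it `c(Rs + Y) ≤ Rs + Y ≤
  -- (n + 1)(s + 1)`, whence both constants.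
  let A : ℕ → Set E := fun n => {e | ((n : ℝ) + 1)⁻¹ ≤ m.β z z' e * m.R z z' e ∧
    m.R z z' e ≤ n + 1 ∧ m.Y z z' e ≤ n + 1}
  have hAm : ∀ n, MeasurableSet (A n) := fun n =>
    (measurableSet_le measurable_const ((m.β_meas z z').mul (m.R_meas z z'))).inter
      ((measurableSet_le (m.R_meas z z') measurable_const).inter
        (measurableSet_le (m.Y_meas z z') measurable_const))
  obtain ⟨n, hn⟩ : ∃ n, m.law (A n) ≠ 0 := by
    by_contra! h
    refine hβR.ne' (measure_mono_null (fun e he => ?_) (measure_iUnion_null h))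
    have he : 0 < m.β z z' e * m.R z z' e := he
    obtain ⟨n, hn⟩ := exists_nat_ge (max (m.β z z' e * m.R z z' e)⁻¹
      (max (m.R z z' e) (m.Y z z' e)))
    simp only [max_le_iff] at hn
    refine Set.mem_iUnion.2 ⟨n, ?_, by linarith, by linarith⟩
    rw [inv_le_comm₀ (by positivity) he]
    linarith
  have hC : (0 : ℝ) < (n : ℝ) + 1 := by positivity
  have hμ : 0 < (m.law (A n)).toReal := ENNReal.toReal_pos hn (measure_ne_top _ _)
  refine ⟨m.P z z' * (((n : ℝ) + 1)⁻¹ * (m.law (A n)).toReal), (n : ℝ) + 1, by positivity, hC,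
    fun s hs => ?_⟩
  have h1 : ∫⁻ e, (A n).indicator (fun _ => ENNReal.ofReal ((n : ℝ) + 1)⁻¹ *
      m.duE z' (((n : ℝ) + 1) * (s + 1))) e ∂m.law ≤
      ∫⁻ e, ENNReal.ofReal (m.β z z' e * m.R z z' e) *
        m.duE z' (c (m.R z z' e * s + m.Y z z' e) z') ∂m.law := by
    refine lintegral_mono_ae ?_
    filter_upwards [hA.ae_Y_pos hP] with e he
    by_cases hAe : e ∈ A n
    · rw [Set.indicator_of_mem hAe]
      gcongr
      · exact hAe.1
      · refine m.antitone_duE z' ((hc.le _ _ (add_pos_of_nonneg_of_pos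
          (mul_nonneg (m.R_nonneg _ _ _) hs) he)).trans ?_)
        have := mul_le_mul_of_nonneg_right hAe.2.1 hs
        linarith [hAe.2.2]
    · rw [Set.indicator_of_notMem hAe]; exact zero_le
  rw [lintegral_indicator_const (hAm n)] at h1
  calc ENNReal.ofReal (m.P z z' * (((n : ℝ) + 1)⁻¹ * (m.law (A n)).toReal)) *
        m.duE z' (((n : ℝ) + 1) * (s + 1))
      = ENNReal.ofReal (m.P z z') * (ENNReal.ofReal ((n : ℝ) + 1)⁻¹ *
          m.duE z' (((n : ℝ) + 1) * (s + 1)) * m.law (A n)) := by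
        rw [ENNReal.ofReal_mul hP.le, ENNReal.ofReal_mul (by positivity),
          ENNReal.ofReal_toReal (measure_ne_top _ _)]
        ring
    _ ≤ ENNReal.ofReal (m.P z z') * ∫⁻ e, ENNReal.ofReal (m.β z z' e * m.R z z' e) *
        m.duE z' (c (m.R z z' e * s + m.Y z z' e) z') ∂m.law := by gcongr
    _ ≤ m.eulerRHS c z s :=
        Finset.single_le_sum (f := fun z' => ENNReal.ofReal (m.P z z') *
          ∫⁻ e, ENNReal.ofReal (m.β z z' e * m.R z z' e) *
            m.duE z' (c (m.R z z' e * s + m.Y z z' e) z') ∂m.law) (fun _ _ => zero_le)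
          (Finset.mem_univ z')

namespace IsOptimalConsumption

theorem eulerRHS_le (hc : m.IsOptimalConsumption c) {w : ℝ} (hw : 0 < w) (z : Fin N × Fin M) :
    m.eulerRHS c z (w - c w z) ≤ m.duE z (c w z) := by
  rw [hc.2.duE_eq hw]; exact le_max_left _ _

theorem exists_le_rpow (hA : m.StandingAssumptions) (hc : m.IsOptimalConsumption c)
    {z z' : Fin N × Fin M} (hP : 0 < m.P z z')
    (hβR : 0 < m.law {e | 0 < m.β z z' e * m.R z z' e}) :
    ∃ κ : ℝ, 0 < κ ∧ ∀ w, 0 < w →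
      κ * (w - c w z + 1) ^ (-m.γ z'.1) ≤ c w z ^ (-m.γ z.1) := by
  obtain ⟨κ, C, hκ, hC, h⟩ := exists_le_eulerRHS hA hc.1 hP hβR
  refine ⟨κ * C ^ (-m.γ z'.1), by positivity, fun w hw => ?_⟩
  have hs := sub_nonneg.2 (hc.1.le w z hw)
  have h1 := (h _ hs).trans (hc.eulerRHS_le hw z)
  have hp := hc.1.pos w z hw
  have hq : 0 < C * (w - c w z + 1) := by positivity
  rw [m.duE_of_pos z hp, m.duE_of_pos z' hq, ← ENNReal.ofReal_mul hκ.le,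
    ENNReal.ofReal_le_ofReal_iff (m.du_pos z hp).le, m.du_eq z hp, m.du_eq z' hq,
    Real.mul_rpow hC.le (by positivity), ← mul_assoc] at h1
  exact h1

/-- If saving were at most `T` at large wealth, consumption would be at least `w - T`. Its marginal
utility would then fall below the positive bound `κ (T + 1)^(-γ(z'))`. -/
theorem tendsto_saving (hA : m.StandingAssumptions) (hc : m.IsOptimalConsumption c)
    {z z' : Fin N × Fin M} (hP : 0 < m.P z z')
    (hβR : 0 < m.law {e | 0 < m.β z z' e * m.R z z' e}) :
    Tendsto (fun w => w - c w z) atTop atTop := by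
  obtain ⟨κ, hκ, h⟩ := hc.exists_le_rpow hA hP hβR
  refine tendsto_atTop.2 fun S => ?_
  set T := max S 0 with hT
  have hT0 : 0 ≤ T := le_max_right _ _
  have hlim : Tendsto (fun w : ℝ => (w - T) ^ (-m.γ z.1)) atTop (𝓝 0) :=
    (tendsto_rpow_neg_atTop (m.γ_pos _)).comp (tendsto_atTop_add_const_right _ (-T) tendsto_id)
  filter_upwards [hlim.eventually_lt_const (show 0 < κ * (T + 1) ^ (-m.γ z'.1) by positivity),
    eventually_gt_atTop T] with w h1 hwT
  have hw : 0 < w := hT0.trans_lt hwT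
  by_contra! hlt
  have hlt' : w - c w z ≤ T := hlt.le.trans (le_max_left _ _)
  have h2 := h w hw
  have h3 : (T + 1) ^ (-m.γ z'.1) ≤ (w - c w z + 1) ^ (-m.γ z'.1) :=
    Real.rpow_le_rpow_of_nonpos (by linarith [hc.1.le w z hw]) (by linarith)
      (neg_nonpos.2 (m.γ_pos _).le)
  have h4 : c w z ^ (-m.γ z.1) ≤ (w - T) ^ (-m.γ z.1) :=
    Real.rpow_le_rpow_of_nonpos (by linarith) (by linarith) (neg_nonpos.2 (m.γ_pos _).le)
  have h5 := mul_le_mul_of_nonneg_left h3 hκ.le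
  linarith

/-- If `c ≥ ε w` with `w ≥ 1`, then `s + 1 ≤ 2w` turns the power bound into `κ (2w)^(-γ(z')) ≤ (ε
w)^(-γ(z))`, which bounds `w^(γ(z) - γ(z'))`. -/
theorem tendsto_div_of_lt (hA : m.StandingAssumptions) (hc : m.IsOptimalConsumption c)
    {z z' : Fin N × Fin M} (hP : 0 < m.P z z')
    (hβR : 0 < m.law {e | 0 < m.β z z' e * m.R z z' e}) (hγ : m.γ z'.1 < m.γ z.1) :
    Tendsto (fun w => c w z / w) atTop (𝓝 0) := by
  obtain ⟨κ, hκ, h⟩ := hc.exists_le_rpow hA hP hβR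
  refine Metric.tendsto_atTop'.2 fun ε hε => ?_
  have hlim : Tendsto (fun w : ℝ => κ * 2 ^ (-m.γ z'.1) * w ^ (m.γ z.1 - m.γ z'.1)) atTop atTop :=
    (tendsto_rpow_atTop (sub_pos.2 hγ)).const_mul_atTop (by positivity)
  obtain ⟨W, hW⟩ := ((hlim.eventually_gt_atTop (ε ^ (-m.γ z.1))).and
    (eventually_ge_atTop 1)).exists_forall_of_atTop
  refine ⟨W, fun w hw => ?_⟩
  obtain ⟨h1, hw1⟩ := hW w hw.le
  have hw0 : 0 < w := by linarith
  have hp := hc.1.pos w z hw0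
  rw [Real.dist_eq, sub_zero, abs_of_pos (div_pos hp hw0), div_lt_iff₀ hw0]
  by_contra! hle
  have h2 : c w z ^ (-m.γ z.1) ≤ (ε * w) ^ (-m.γ z.1) :=
    Real.rpow_le_rpow_of_nonpos (by positivity) hle (neg_nonpos.2 (m.γ_pos _).le)
  have h3 : (2 * w) ^ (-m.γ z'.1) ≤ (w - c w z + 1) ^ (-m.γ z'.1) :=
    Real.rpow_le_rpow_of_nonpos (by linarith [hc.1.le w z hw0]) (by linarith)
      (neg_nonpos.2 (m.γ_pos _).le)
  have h4 := ((mul_le_mul_of_nonneg_left h3 hκ.le).trans (h w hw0)).trans h2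
  rw [Real.mul_rpow hε.le hw0.le, Real.mul_rpow zero_le_two hw0.le] at h4
  have h5 : w ^ (m.γ z.1 - m.γ z'.1) = w ^ (-m.γ z'.1) * w ^ m.γ z.1 := by
    rw [← Real.rpow_add hw0]; congr 1; ring
  have h6 : w ^ (-m.γ z.1) * w ^ m.γ z.1 = 1 := by
    rw [← Real.rpow_add hw0, neg_add_cancel, Real.rpow_zero]
  have h7 : 0 < w ^ m.γ z.1 := by positivity
  have h8 := mul_le_mul_of_nonneg_right h4 h7.le
  rw [mul_assoc (ε ^ _), h6, mul_one, ← mul_assoc, mul_assoc, ← h5] at h8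
  linarith

end IsOptimalConsumption

/-! ### Asymptotics from a fixed risk aversion level -/

/-- The lower limit of `(w / c(w, z)) ^ γ(z)` as wealth tends to infinity. -/
noncomputable def liminfRatio (m : SavingsModel N M E) (c : ℝ → Fin N × Fin M → ℝ)
    (z : Fin N × Fin M) : ℝ≥0∞ :=
  liminf (fun w => ENNReal.ofReal ((w / c w z) ^ m.γ z.1)) atTop

theorem IsCandidate.tendsto_div_of_liminfRatio (hc : m.IsCandidate c) {z : Fin N × Fin M}
    (h : m.liminfRatio c z = ⊤) : Tendsto (fun w => c w z / w) atTop (𝓝 0) := by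
  refine Metric.tendsto_atTop'.2 fun ε hε => ?_
  have h1 : ∀ᶠ w in atTop, ENNReal.ofReal (ε⁻¹ ^ m.γ z.1) <
      ENNReal.ofReal ((w / c w z) ^ m.γ z.1) :=
    eventually_lt_of_lt_liminf (show _ < m.liminfRatio c z by rw [h]; exact ENNReal.ofReal_lt_top)
  obtain ⟨W, hW⟩ := (h1.and (eventually_gt_atTop 0)).exists_forall_of_atTop
  refine ⟨W, fun w hw => ?_⟩
  obtain ⟨h2, hw0⟩ := hW w hw.le
  have hp := hc.pos w z hw0
  have h3 := (ENNReal.ofReal_lt_ofReal_iff_of_nonneg (by positivity)).1 h2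
  rw [Real.rpow_lt_rpow_iff (by positivity) (by positivity) (m.γ_pos _), inv_lt_comm₀ hε
    (by positivity), inv_div] at h3
  rw [Real.dist_eq, sub_zero, abs_of_pos (div_pos hp hw0)]
  exact h3

/-- With `x = R s + Y`, the right-hand expression is `b R (s/x)^γ · (x/c(x))^γ`. The first factor
tends to `b R^(1-γ)`, and `x → ∞` controls the second. -/
theorem IsCandidate.one_div_rpow_mul_liminfRatio_le (hc : m.IsCandidate c) (z : Fin N × Fin M)
    {b R Y : ℝ} (hb : 0 ≤ b) (hR : 0 < R) (hY : 0 < Y) :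
    ENNReal.ofReal (b * R ^ (1 - m.γ z.1)) * m.liminfRatio c z ≤
      liminf (fun s => ENNReal.ofReal (s ^ m.γ z.1) * (ENNReal.ofReal (b * R) *
        m.duE z (c (R * s + Y) z))) atTop := by
  have hx : Tendsto (fun s : ℝ => R * s + Y) atTop atTop :=
    tendsto_atTop_add_const_right _ _ (tendsto_id.const_mul_atTop hR)
  have hu : Tendsto (fun s : ℝ => ENNReal.ofReal (b * R * (s / (R * s + Y)) ^ m.γ z.1)) atTop
      (𝓝 (ENNReal.ofReal (b * R ^ (1 - m.γ z.1)))) := by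
    refine ENNReal.tendsto_ofReal ?_
    have h1 : Tendsto (fun s : ℝ => s / (R * s + Y)) atTop (𝓝 R⁻¹) := by
      have h2 : Tendsto (fun s : ℝ => (R + Y * s⁻¹)⁻¹) atTop (𝓝 R⁻¹) := by
        have := (tendsto_inv_atTop_zero.const_mul Y).const_add R
        rw [mul_zero, add_zero] at this
        exact this.inv₀ hR.ne'
      refine h2.congr' ?_
      filter_upwards [eventually_gt_atTop 0] with s hs
      field_simp
    have h2 := (h1.rpow_const (p := m.γ z.1) (Or.inl (inv_pos.2 hR).ne')).const_mul (b * R)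
    have h3 : b * R ^ (1 - m.γ z.1) = b * R * R⁻¹ ^ m.γ z.1 := by
      rw [Real.rpow_sub hR, Real.rpow_one, Real.inv_rpow hR.le]; ring
    rwa [h3]
  have hv : m.liminfRatio c z ≤ liminf (fun s : ℝ =>
      ENNReal.ofReal (((R * s + Y) / c (R * s + Y) z) ^ m.γ z.1)) atTop :=
    liminf_le_liminf_of_le (u := fun w => ENNReal.ofReal ((w / c w z) ^ m.γ z.1)) hx
  rw [← hu.liminf_eq]
  refine (mul_le_mul_right hv _).trans (ENNReal.le_liminf_mul.trans (le_of_eq ?_))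
  refine liminf_congr ?_
  filter_upwards [eventually_gt_atTop 0] with s hs
  have hpos : 0 < R * s + Y := by positivity
  have hp := hc.pos _ z hpos
  rw [m.duE_of_pos z hp, m.du_eq z hp, Pi.mul_apply, ← ENNReal.ofReal_mul (by positivity),
    ← ENNReal.ofReal_mul (by positivity), ← ENNReal.ofReal_mul (by positivity)]
  congr 1
  rw [Real.div_rpow hs.le hpos.le, Real.div_rpow hpos.le hp.le, Real.rpow_neg hp.le]
  have : 0 < (R * s + Y) ^ m.γ z.1 := by positivity
  field_simp

/-- Fatou's lemma over the innovation and over `k`, applied to the bound for a fixed shock. -/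
theorem IsCandidate.sum_GE_mul_liminfRatio_le (hA : m.StandingAssumptions) (hc : m.IsCandidate c)
    (i : Fin N) (j : Fin M) :
    ∑ k, m.GE i j k * m.liminfRatio c (i, k) ≤
      liminf (fun s => ENNReal.ofReal (s ^ m.γ i) * m.eulerRHS c (i, j) s) atTop := by
  let f : Fin M → ℝ → E → ℝ≥0∞ := fun k s e => ENNReal.ofReal (s ^ m.γ i) *
    (ENNReal.ofReal (m.β (i, j) (i, k) e * m.R (i, j) (i, k) e) *
      if 0 < m.R (i, j) (i, k) e * s + m.Y (i, j) (i, k) e then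
        m.duE (i, k) (c (m.R (i, j) (i, k) e * s + m.Y (i, j) (i, k) e) (i, k)) else ⊤)
  have hf : ∀ k s, Measurable (f k s) := fun k s =>
    (((m.β_meas _ _).mul (m.R_meas _ _)).ennreal_ofReal.mul
      ((hc.measurable_duE (i, k)).comp
        (((m.R_meas (i, j) (i, k)).mul_const s).add (m.Y_meas (i, j) (i, k))))).const_mul _
  have hterm : ∀ k, m.GE i j k * m.liminfRatio c (i, k) ≤
      liminf (fun s => ENNReal.ofReal (m.P (i, j) (i, k)) * ∫⁻ e, f k s e ∂m.law) atTop := by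
    intro k
    have hGE : m.GE i j k = ENNReal.ofReal (m.P (i, j) (i, k)) * m.Q i j k := by
      rw [GE, ← mul_assoc, ← ENNReal.ofReal_mul (m.Pbar_nonneg _ _)]; rfl
    rcases (m.P_nonneg (i, j) (i, k)).eq_or_lt with h0 | h0
    · rw [hGE, ← h0]; simp
    rw [hGE, mul_assoc, ENNReal.liminf_const_mul_of_ne_top ENNReal.ofReal_ne_top]
    gcongr
    refine (lintegral_mul_const_le _ _).trans (le_trans ?_ (lintegral_liminf_le (hf k)))
    refine lintegral_mono_ae ?_
    filter_upwards [hA.ae_Y_pos h0] with e he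
    by_cases hR : 0 < m.R (i, j) (i, k) e
    · rw [if_pos hR]
      refine (hc.one_div_rpow_mul_liminfRatio_le (i, k) (m.β_nonneg _ _ e) hR he).trans
        (le_of_eq (liminf_congr ?_))
      filter_upwards [eventually_gt_atTop 0] with s hs
      simp only [f]
      rw [if_pos (by positivity)]
    · rw [if_neg hR, zero_mul]; exact zero_le
  refine (Finset.sum_le_sum fun k _ => hterm k).trans ((ENNReal.sum_liminf_le _).trans ?_)
  refine liminf_le_liminf ?_
  filter_upwards [eventually_ge_atTop 0] with s hs
  have h1 : ∀ k, ENNReal.ofReal (m.P (i, j) (i, k)) * ∫⁻ e, f k s e ∂m.law =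
      ENNReal.ofReal (s ^ m.γ i) * (ENNReal.ofReal (m.P (i, j) (i, k)) *
        ∫⁻ e, ENNReal.ofReal (m.β (i, j) (i, k) e * m.R (i, j) (i, k) e) *
          m.duE (i, k) (c (m.R (i, j) (i, k) e * s + m.Y (i, j) (i, k) e) (i, k)) ∂m.law) := by
    intro k
    rcases (m.P_nonneg (i, j) (i, k)).eq_or_lt with h0 | h0
    · rw [← h0]; simp
    rw [mul_left_comm (ENNReal.ofReal (s ^ m.γ i)),
      ← lintegral_const_mul' (ENNReal.ofReal (s ^ m.γ i)) _ ENNReal.ofReal_ne_top]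
    congr 1
    refine lintegral_congr_ae ?_
    filter_upwards [hA.ae_Y_pos h0] with e he
    simp only [f]
    rw [if_pos (add_pos_of_nonneg_of_pos (mul_nonneg (m.R_nonneg _ _ _) hs) he)]
  simp only [h1]
  rw [← Finset.mul_sum]
  gcongr
  unfold eulerRHS expect
  rw [Fintype.sum_prod_type]
  -- Transitions that change the risk aversion are discarded.
  exact Finset.single_le_sum (f := fun i' => ∑ k, ENNReal.ofReal (m.P (i, j) (i', k)) *
      ∫⁻ e, ENNReal.ofReal (m.β (i, j) (i', k) e * m.R (i, j) (i', k) e) *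
        m.duE (i', k) (c (m.R (i, j) (i', k) e * s + m.Y (i, j) (i', k) e) (i', k)) ∂m.law)
    (fun _ _ => zero_le) (Finset.mem_univ i)

/-- With `s = w - c`, the Euler inequality bounds `(s/c)^γ` below by `s^γ` times the Euler term.
Since `w/c = 1 + s/c`, applying the increasing continuous `φ` and letting `s → ∞` gives the claim.
-/
theorem IsOptimalConsumption.rpow_le_liminfRatio (hA : m.StandingAssumptions)
    (hc : m.IsOptimalConsumption c) (i : Fin N) (j : Fin M)
    (hs : Tendsto (fun w => w - c w (i, j)) atTop atTop) :
    (1 + (∑ k, m.GE i j k * m.liminfRatio c (i, k)) ^ (m.γ i)⁻¹) ^ m.γ i ≤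
      m.liminfRatio c (i, j) := by
  have hγ := m.γ_pos i
  set φ : ℝ≥0∞ → ℝ≥0∞ := fun x => (1 + x ^ (m.γ i)⁻¹) ^ m.γ i with hφ
  have hmono : Monotone φ := fun x y hxy => by simp only [hφ]; gcongr
  have hcont : Continuous φ := ENNReal.continuous_rpow_const.comp
    (continuous_const.add ENNReal.continuous_rpow_const)
  set Ψ : ℝ → ℝ≥0∞ := fun s => ENNReal.ofReal (s ^ m.γ i) * m.eulerRHS c (i, j) s with hΨ
  calc φ (∑ k, m.GE i j k * m.liminfRatio c (i, k)) ≤ φ (liminf Ψ atTop) :=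
        hmono (hc.1.sum_GE_mul_liminfRatio_le hA i j)
    _ = liminf (φ ∘ Ψ) atTop := hmono.map_liminf_of_continuousAt Ψ hcont.continuousAt
    _ ≤ liminf (fun w => φ (Ψ (w - c w (i, j)))) atTop :=
        liminf_le_liminf_of_le (u := φ ∘ Ψ) hs
    _ ≤ m.liminfRatio c (i, j) := by
        refine liminf_le_liminf ?_
        filter_upwards [eventually_gt_atTop 0, hs.eventually_gt_atTop 0] with w hw hsw
        have hp := hc.1.pos w (i, j) hw
        have h1 : Ψ (w - c w (i, j)) ≤
            ENNReal.ofReal (((w - c w (i, j)) / c w (i, j)) ^ m.γ i) := by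
          refine (mul_le_mul_right (hc.eulerRHS_le hw (i, j)) _).trans (le_of_eq ?_)
          rw [m.duE_of_pos _ hp, m.du_eq _ hp, ← ENNReal.ofReal_mul (by positivity),
            Real.div_rpow hsw.le hp.le, Real.rpow_neg hp.le, div_eq_mul_inv]
        refine (hmono h1).trans (le_of_eq ?_)
        have h2 : 0 < (w - c w (i, j)) / c w (i, j) := div_pos hsw hp
        simp only [hφ]
        rw [ENNReal.ofReal_rpow_of_nonneg (by positivity) (by positivity), ← Real.rpow_mul h2.le,
          mul_inv_cancel₀ hγ.ne', Real.rpow_one, ← ENNReal.ofReal_one,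
          ← ENNReal.ofReal_add zero_le_one h2.le,
          ENNReal.ofReal_rpow_of_nonneg (by positivity) hγ.le]
        congr 2
        field_simp
        ring

theorem IsOptimalConsumption.liminfRatio_eq_top (hA : m.StandingAssumptions)
    (hc : m.IsOptimalConsumption c) (i : Fin N)
    (hs : ∀ j, Tendsto (fun w => w - c w (i, j)) atTop atTop) (hfin : ∀ j k, m.GE i j k < ⊤)
    (hirr : MatIrreducible (m.G i)) (hr : 1 ≤ specRad (m.G i)) (j : Fin M) :
    m.liminfRatio c (i, j) = ⊤ := by
  have hγ := m.γ_pos i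
  set y : Fin M → ℝ≥0∞ := fun j => m.liminfRatio c (i, j) with hy
  have key : ∀ j, (1 + (∑ k, m.GE i j k * y k) ^ (m.γ i)⁻¹) ^ m.γ i ≤ y j := fun j =>
    hc.rpow_le_liminfRatio hA i j (hs j)
  by_cases htop : ∃ k, y k = ⊤
  · have hS := hirr.eq_univ (Finset.univ.filter fun k => y k = ⊤)
      (by obtain ⟨k, hk⟩ := htop; exact ⟨k, by simpa using hk⟩) (by
        intro j k hk hG
        have hk : y k = ⊤ := by simpa using hk
        have hGE : m.GE i j k ≠ 0 := fun h => hG (by simp [G, h])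
        have hsum : ∑ k, m.GE i j k * y k = ⊤ := by
          refine top_le_iff.1 ((le_of_eq ?_).trans (Finset.single_le_sum
            (f := fun k => m.GE i j k * y k) (fun _ _ => zero_le) (Finset.mem_univ k)))
          rw [hk, ENNReal.mul_top hGE]
        have h1 := key j
        rw [hsum, ENNReal.top_rpow_of_pos (inv_pos.2 hγ), add_top, ENNReal.top_rpow_of_pos hγ]
          at h1
        simpa using h1)
    have hj : j ∈ Finset.univ.filter fun k => y k = ⊤ := by
      rw [hS]; exact Finset.mem_univ j
    exact (Finset.mem_filter.1 hj).2
  · push Not at htop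
    have hone : ∀ j, 1 ≤ y j := fun j => by
      refine le_trans ?_ (key j)
      exact ENNReal.one_le_rpow le_self_add hγ
    refine absurd hr (not_le.2 (specRad_lt_one_of_mulVec_lt (y := fun k => (y k).toReal)
      (fun _ _ => ENNReal.toReal_nonneg)
      (fun k => ENNReal.toReal_pos (zero_lt_one.trans_le (hone k)).ne' (htop k)) fun j => ?_))
    have hq : ∑ k, m.GE i j k * y k ≠ ⊤ := (ENNReal.sum_lt_top.2 fun k _ =>
      ENNReal.mul_lt_top (hfin j k) (htop k).lt_top).ne
    -- Strict because `φ(x) > x` for finite `x`.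
    have hlt : ∑ k, m.GE i j k * y k < y j := by
      refine lt_of_lt_of_le ?_ (key j)
      calc ∑ k, m.GE i j k * y k = ((∑ k, m.GE i j k * y k) ^ (m.γ i)⁻¹) ^ m.γ i := by
            rw [← ENNReal.rpow_mul, inv_mul_cancel₀ hγ.ne', ENNReal.rpow_one]
        _ < _ := by
            refine ENNReal.rpow_lt_rpow ?_ hγ
            rw [add_comm]
            exact ENNReal.lt_add_right (ENNReal.rpow_ne_top_of_nonneg (inv_pos.2 hγ).le hq)
              one_ne_zero
    have h1 := ENNReal.toReal_strict_mono (htop j) hlt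
    rw [ENNReal.toReal_sum fun k _ => ENNReal.mul_ne_top (hfin j k).ne (htop k)] at h1
    simpa [G, ENNReal.toReal_mul] using h1

end SavingsModel

/-! ### Conclusion -/

theorem theorem3p2 {N M : ℕ} [NeZero N] [NeZero M] {E : Type*} [MeasurableSpace E]
    (m : SavingsModel N M E) (hA : m.StandingAssumptions)
    (hP : ∀ i k, 0 < m.Pbar i k)
    (hβR : ∀ z z', 0 < m.law {e | 0 < m.β z z' e * m.R z z' e}) :
    ∃ c : ℝ → Fin N × Fin M → ℝ,
      m.IsOptimalConsumption c ∧
      (∀ c', m.IsOptimalConsumption c' → ∀ w z, 0 < w → c' w z = c w z) ∧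
      (∀ (i : Fin N) (j : Fin M), i ≠ 0 →
        Tendsto (fun w => c w (i, j) / w) atTop (𝓝 0)) ∧
      ((∀ j k, m.GE 0 j k < ⊤) → MatIrreducible (m.G 0) → 1 ≤ specRad (m.G 0) →
        ∀ (i : Fin N) (j : Fin M), Tendsto (fun w => c w (i, j) / w) atTop (𝓝 0)) := by
  obtain ⟨h, θ, hθ0, hθ1, hh, hKh⟩ := hA.exists_weight
  obtain ⟨c, hc⟩ := SavingsModel.exists_isOptimalConsumption_of_weight hA hh hKh hθ0.le hθ1
  -- Positivity of `Pbar` reaches every risk aversion level in one step; some `l` is available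
  -- because the rows of `Ptil` sum to one.
  have hP' : ∀ (i k : Fin N) (j : Fin M), ∃ l, 0 < m.P (i, j) (k, l) := by
    intro i k j
    obtain ⟨l, -, hl⟩ : ∃ l ∈ Finset.univ, 0 < m.Ptil j l :=
      Finset.exists_lt_of_sum_lt (f := fun _ => (0 : ℝ)) (by simp [m.Ptil_sum])
    exact ⟨l, mul_pos (hP i k) hl⟩
  have hlow : ∀ (i : Fin N) (j : Fin M), i ≠ 0 →
      Tendsto (fun w => c w (i, j) / w) atTop (𝓝 0) := by
    intro i j hi
    obtain ⟨l, hl⟩ := hP' i 0 j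
    exact hc.tendsto_div_of_lt hA hl (hβR _ _) (m.γ_strictMono (Fin.pos_iff_ne_zero.2 hi))
  refine ⟨c, hc, fun c' hc' w z hw => hc'.eqOn hA hh hKh hθ0.le hθ1 hc z hw, hlow,
    fun hfin hirr hr i j => ?_⟩
  by_cases hi : i = 0
  · subst hi
    refine hc.1.tendsto_div_of_liminfRatio (hc.liminfRatio_eq_top hA 0 (fun j => ?_) hfin hirr hr j)
    obtain ⟨l, hl⟩ := hP' 0 0 j
    exact hc.tendsto_saving hA hl (hβR _ _)
  · exact hlow i j hi
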